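/- Let $P\subset\mathbb{R}^e$ be a polytope of dimension $d\ge 0$ and let $c$ be a linear function on $\mathbb{R}^e$ that takes distinct values at distinct vertices of $P$. For each nonempty face $F$ of $P$ let its apex $v_F$ be the vertex of $F$ at which $c$ attains its minimum over $F$. The pointed triangulation of $P$ with apexes $V(P)=\{v_F\}$ is $$\mathcal{C}_P=\{\emptyset\}\cup\big\{\operatorname{conv}\{v_{G_1},\dots,v_{G_k}\}\;:\;k\ge 1,\ G_1\supsetneq G_2\supsetneq\cdots\supsetneq G_k \text{ nonempty faces of } P,\ v_{G_i}\notin G_{i+1}\text{ for }1\le i<k\big\}.$$ Recall that a polytopal complex is a finite set of polytopes that contains $\emptyset$, contains every face of each of its members, and in which the intersection of any two members is a face of both; its facets are its inclusion-maximal members, and it is pure of dimension $d$ if all its facets have dimension $d$. A shelling of a pure $d$-dimensional polytopal complex is a linear ordering $F_1,\dots,F_s$ of its facets such that either $d=0$, or (1) the complex of proper faces of $F_1$ has a shelling, and (2) for every $j\ge 2$ the set $F_j\cap(F_1\cup\dots\cup F_{j-1})$ is nonempty and equals $F'_1\cup\dots\cup F'_r$ for some shelling $F'_1,\dots,F'_r,\dots,F'_{s'}$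 of the complex of proper faces of $F_j$. Then $\mathcal{C}_P$ is a triangulation of $P$, that is, a polytopal complex consisting of simplices whose union is $P$; it is pure of dimension $d$, and there is a shelling $\alpha_1,\dots,\alpha_s$ of $\mathcal{C}_P$ (an ordering of its $d$-simplices) such that for every $j\in\{2,\dots,s\}$ the number $l_j$ of facets of $\alpha_j$ contained in $\alpha_j\cap\bigcup_{i<j}\alpha_i$ satisfies $1\le l_j\le d-1$. -/

import Mathlib

namespace PointedTriangulation

section

variable {E : Type*} [NormedAddCommGroup E] [NormedSpace ℝ E]

/-- A polytope: the convex hull of a finite (possibly empty) set of points. -/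
def IsPolytope (P : Set E) : Prop :=
  ∃ t : Finset E, P = convexHull ℝ (t : Set E)

/-- `P` is nonempty and its affine hull has dimension `k`. (The empty set, which has
dimension `-1`, has no dimension `k : ℕ` in this sense.) -/
def HasDim (P : Set E) (k : ℕ) : Prop :=
  P.Nonempty ∧ Module.finrank ℝ (vectorSpan ℝ P) = k

/-- `F` is a face of `P`: either empty, or the set where some linear function attains its maximum
over `P`. In particular `∅` and `P` are faces of `P`. -/
def IsFace (P F : Set E) : Prop :=
  IsExposed ℝ P F

/-- A simplex: the convex hull of a finite (possibly empty) affinely independent set of points. -/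
def IsSimplex (S : Set E) : Prop :=
  ∃ t : Finset E, AffineIndependent ℝ ((↑) : t → E) ∧ S = convexHull ℝ (t : Set E)

/-- `F` is a facet of the `d`-polytope `P`, that is, a face of dimension `d - 1`. -/
def IsFacet (d : ℕ) (P F : Set E) : Prop :=
  IsFace P F ∧ ∃ k : ℕ, k + 1 = d ∧ HasDim F k

/-- A polytopal complex. -/
structure IsPolytopalComplex (C : Set (Set E)) : Prop where
  finite : C.Finite
  polytope : ∀ F ∈ C, IsPolytope F
  empty_mem : ∅ ∈ C
  face_mem : ∀ F ∈ C, ∀ G, IsFace F G → G ∈ C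
  inter_face : ∀ F ∈ C, ∀ G ∈ C, IsFace F (F ∩ G) ∧ IsFace G (F ∩ G)

/-- The facets of a complex: its inclusion-maximal members. -/
def complexFacets (C : Set (Set E)) : Set (Set E) :=
  {F | Maximal (· ∈ C) F}

/-- `C` is a pure polytopal complex of dimension `d`. -/
def IsPureComplex (d : ℕ) (C : Set (Set E)) : Prop :=
  IsPolytopalComplex C ∧ ∀ F ∈ complexFacets C, HasDim F d

/-- `C` is a triangulation of `P`: a polytopal complex of simplices with underlying set `P`. -/
def IsTriangulation (P : Set E) (C : Set (Set E)) : Prop :=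
  IsPolytopalComplex C ∧ (∀ S ∈ C, IsSimplex S) ∧ ⋃₀ C = P

/-- The boundary complex of a polytope: the complex of its proper faces. -/
def boundaryComplex (P : Set E) : Set (Set E) :=
  {F | IsFace P F ∧ F ≠ P}

/-- The intersection of the `j`-th member of a sequence of sets with the union of the earlier
members. -/
def earlierInter {s : ℕ} (α : Fin s → Set E) (j : Fin s) : Set E :=
  α j ∩ ⋃ i : Fin s, ⋃ _ : i < j, α i

/-- `α 0, …, α (s - 1)` is a shelling of the pure `d`-dimensional polytopal complex `C`:
a linear ordering of the facets of `C` such that either `d = 0`, or the boundary complex of the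
first facet has a shelling and the intersection of every later facet with the union of
the previous ones is nonempty and is the union of a beginning segment of a shelling of
the boundary complex of that facet. -/
def IsShelling : (d : ℕ) → (C : Set (Set E)) → (s : ℕ) → (α : Fin s → Set E) → Prop
  | 0, C, _, α =>
      IsPureComplex 0 C ∧ Function.Injective α ∧ Set.range α = complexFacets C
  | d + 1, C, s, α =>
      (IsPureComplex (d + 1) C ∧ Function.Injective α ∧ Set.range α = complexFacets C) ∧
      (∀ j : Fin s, (j : ℕ) = 0 →
        ∃ (s' : ℕ) (β : Fin s' → Set E), IsShelling d (boundaryComplex (α j)) s' β) ∧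
      (∀ j : Fin s, 0 < (j : ℕ) →
        (earlierInter α j).Nonempty ∧
        ∃ (s' : ℕ) (β : Fin s' → Set E), IsShelling d (boundaryComplex (α j)) s' β ∧
          ∃ r : ℕ, r ≤ s' ∧ earlierInter α j = ⋃ i : Fin s', ⋃ _ : (i : ℕ) < r, β i)

/-- The linear function `c` is in general position with respect to the polytope `P`: it takes
distinct values at distinct vertices of `P`. -/
def InGeneralPosition (c : E →L[ℝ] ℝ) (P : Set E) : Prop :=
  Set.InjOn c (P.extremePoints ℝ)

/-- `v` is the apex of the face `F` with respect to `c`: the vertex of `F` at which `c` attains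
its minimum over `F`. -/
def IsApex (c : E →L[ℝ] ℝ) (F : Set E) (v : E) : Prop :=
  v ∈ F.extremePoints ℝ ∧ ∀ y ∈ F, c v ≤ c y

/-- The pointed triangulation of `P` determined by `c`: the convex hulls of all sets of
apexes `v 0, …, v (k - 1)` of strictly decreasing chains `G 0 ⊋ ⋯ ⊋ G (k - 1)` of nonempty faces
of `P` such that no `v i` lies in the next face of the chain (equivalently, in
any later one). For `k = 0` this is the empty set. -/
def pointedTriangulation (c : E →L[ℝ] ℝ) (P : Set E) : Set (Set E) :=
  {S | ∃ (k : ℕ) (G : Fin k → Set E) (v : Fin k → E),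
      (∀ i, IsFace P (G i) ∧ (G i).Nonempty ∧ IsApex c (G i) (v i)) ∧
      (∀ i j, i < j → G j ⊂ G i ∧ v i ∉ G j) ∧
      S = convexHull ℝ (Set.range v)}

/-- The number of facets of the `d`-polytope `α j` that lie in the intersection of `α j` with the
union of the earlier `α i`. -/
noncomputable def overlapCount (d : ℕ) {s : ℕ} (α : Fin s → Set E) (j : Fin s) : ℕ :=
  {F : Set E | IsFacet d (α j) F ∧ F ⊆ earlierInter α j}.ncard

end

end PointedTriangulation

namespace PointedTriangulation

open scoped Classical
open Set

variable {E : Type*} [NormedAddCommGroup E] [NormedSpace ℝ E]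

/-! The maximal simplices of the complex come from complete flags: start with `P` and its apex `v`,
pass to a face that avoids `v` and spans `P` together with `v`, and repeat until a point remains
(`IsFlag`). Flag simplices cover `P`, because the ray from the apex through any other point leaves
`P` in such a face (`exists_isFlag_mem`). Every chain in the definition refines to a flag, and every
subset of a flag comes from a chain, so the complex consists of the faces of the flag simplices
(`pointedTriangulation_eq`).

The triangulation is regular. Give a vertex `u` the height `exp (-r c(u))` with `r` large. If a
vertex `v` is not in the flag `W`, write it as an affine combination of `W`: the vertex with least
`c` among those with nonzero coefficient has a positive coefficient and lies below `v`
(`IsFlag.exists_weights`). For large `r` its term dominates, so `v` is strictly below the affine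
function interpolating the heights on `W`. Hence on each simplex its own interpolant is the
pointwise minimum of all of them, and simplices meet in common faces
(`IsRegularFamily.isSimplexFamily`).

For the shelling, choose `q` in `P` at which all interpolants differ and order the simplices by
their value at `q`. A simplex then meets the union of its predecessors exactly in its facets visible
from `q`, those opposite to vertices with negative barycentric coordinate at `q`
(`mem_visible_of_lower`, `exists_lower_of_visible`). Any ordering of the facets of a simplex is a
shelling, so the visible ones may come first. A simplex that is not the first does not contain `q`,
so it has a visible facet. With `d` visible facets, the remaining vertex would be an interior point
of a segment from `q` to a point of the simplex, or equal `q`; neither is possible, since it is a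
vertex of `P` and `q` lies in `P` (`card_visible_lt`). -/

/-- **Farkas' lemma** for finitely many generators. -/
theorem farkas {ι : Type*} (s : Finset ι) (a : ι → E) (b : E) :
    (∃ w : ι → ℝ, (∀ i ∈ s, 0 ≤ w i) ∧ ∑ i ∈ s, w i • a i = b) ∨
      ∃ l : E →L[ℝ] ℝ, (∀ i ∈ s, 0 ≤ l (a i)) ∧ l b < 0 := by
  induction s using Finset.induction_on generalizing a b with
  | empty =>
    by_cases hb : b = 0
    · exact Or.inl ⟨0, by simp, by simp [hb]⟩
    · right
      obtain ⟨l, hl⟩ := SeparatingDual.exists_ne_zero (R := ℝ) hb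
      rcases lt_or_gt_of_ne hl with h | h
      · exact ⟨l, by simp, h⟩
      · exact ⟨-l, by simp, by simpa using h⟩
  | insert n s hn ih =>
    rcases ih a b with ⟨w, hw, hwb⟩ | ⟨l, hl, hlb⟩
    · left
      refine ⟨Function.update w n 0, ?_, ?_⟩
      · intro i hi
        rcases Finset.mem_insert.1 hi with rfl | his
        · simp
        · rw [Function.update_of_ne (by rintro rfl; exact hn his)]
          exact hw i his
      · rw [Finset.sum_insert hn, Function.update_self, zero_smul, zero_add, ← hwb]
        refine Finset.sum_congr rfl fun i hi => ?_
        rw [Function.update_of_ne (by rintro rfl; exact hn hi)]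
    · rcases le_or_gt 0 (l (a n)) with hln | hln
      · right
        refine ⟨l, ?_, hlb⟩
        intro i hi
        rcases Finset.mem_insert.1 hi with rfl | hi
        exacts [hln, hl i hi]
      -- When `l (a n) < 0`, project along `a n` onto the kernel of `l` and apply the induction
      -- hypothesis there. A cone representation lifts with a nonnegative coefficient of `a n` by
      -- the signs of `l`; a separating functional pulls back along the projection.
      · rcases ih (fun i => a i - (l (a i) / l (a n)) • a n) (b - (l b / l (a n)) • a n) with
          ⟨w, hw, hwb⟩ | ⟨m, hm, hmb⟩
        · left
          refine ⟨Function.update w n (l b / l (a n) - ∑ i ∈ s, w i * (l (a i) / l (a n))), ?_, ?_⟩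
          · intro i hi
            rcases Finset.mem_insert.1 hi with rfl | his
            · rw [Function.update_self, sub_nonneg]
              refine (Finset.sum_nonpos fun j hj => ?_).trans
                (div_nonneg_of_nonpos hlb.le hln.le)
              exact mul_nonpos_of_nonneg_of_nonpos (hw j hj)
                (div_nonpos_of_nonneg_of_nonpos (hl j hj) hln.le)
            · rw [Function.update_of_ne (by rintro rfl; exact hn his)]
              exact hw i his
          · rw [Finset.sum_insert hn, Function.update_self]
            have h1 : ∑ i ∈ s, Function.update w n
                (l b / l (a n) - ∑ i ∈ s, w i * (l (a i) / l (a n))) i • a i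
                = ∑ i ∈ s, w i • a i := by
              refine Finset.sum_congr rfl fun i hi => ?_
              rw [Function.update_of_ne (by rintro rfl; exact hn hi)]
            rw [h1, sub_smul, Finset.sum_smul]
            simp only [smul_sub, Finset.sum_sub_distrib, smul_smul] at hwb
            rw [sub_eq_sub_iff_add_eq_add] at hwb
            rw [sub_add_eq_add_sub, sub_eq_iff_eq_add, add_comm, hwb]
        · right
          have hval : ∀ x, (m - (m (a n) / l (a n)) • l) x = m (x - (l x / l (a n)) • a n) := by
            intro x
            simp only [sub_apply, smul_apply, map_sub,
              map_smul, smul_eq_mul]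
            ring
          refine ⟨m - (m (a n) / l (a n)) • l, ?_, by rw [hval]; exact hmb⟩
          intro i hi
          rw [hval]
          rcases Finset.mem_insert.1 hi with rfl | hi
          · rw [div_self hln.ne]; simp
          · exact hm i hi

/-! ### Faces of polytopes -/

theorem isCompact_convexHull_finset (t : Finset E) : IsCompact (convexHull ℝ (t : Set E)) :=
  t.finite_toSet.isCompact_convexHull ℝ

theorem le_of_mem_convexHull {s : Set E} (l : E →L[ℝ] ℝ) {M : ℝ} (h : ∀ u ∈ s, l u ≤ M) {x : E}
    (hx : x ∈ convexHull ℝ s) : l x ≤ M :=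
  convexHull_min (t := {x | l x ≤ M}) h (convex_halfSpace_le l.isLinear M) hx

/-- A nonempty face is the set of points of `F` at which a linear function equals its maximum. -/
theorem IsFace.exists_functional {F G : Set E} (h : IsFace F G) (hG : G.Nonempty) :
    ∃ (l : E →L[ℝ] ℝ) (M : ℝ), (∀ x ∈ F, l x ≤ M) ∧ ∀ x, x ∈ G ↔ x ∈ F ∧ l x = M := by
  obtain ⟨l, hl⟩ := h hG
  obtain ⟨g, hg⟩ := hG
  have hg' := hg
  rw [hl] at hg'
  refine ⟨l, l g, hg'.2, fun x => ?_⟩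
  rw [hl]
  constructor
  · rintro ⟨hx, hmax⟩
    exact ⟨hx, le_antisymm (hg'.2 x hx) (hmax g hg'.1)⟩
  · rintro ⟨hx, he⟩
    exact ⟨hx, fun y hy => he ▸ hg'.2 y hy⟩

theorem isFace_of_functional {F G : Set E} (l : E →L[ℝ] ℝ) (M : ℝ) (hM : ∀ x ∈ F, l x ≤ M)
    (hG : ∀ x, x ∈ G ↔ x ∈ F ∧ l x = M) : IsFace F G := by
  rintro ⟨g, hg⟩
  refine ⟨l, Set.ext fun x => ?_⟩
  rw [hG]
  constructor
  · rintro ⟨hx, he⟩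
    exact ⟨hx, fun y hy => he ▸ hM y hy⟩
  · rintro ⟨hx, hmax⟩
    exact ⟨hx, le_antisymm (hM x hx) (((hG g).1 hg).2 ▸ hmax g ((hG g).1 hg).1)⟩

/-- A convex combination of points of `t` attains the maximum of a linear function only if all its
weight sits on points that attain it. -/
theorem IsFace.eq_convexHull_filter {t : Finset E} {G : Set E}
    (h : IsFace (convexHull ℝ (t : Set E)) G) :
    G = convexHull ℝ ((t.filter (· ∈ G) : Finset E) : Set E) := by
  rcases G.eq_empty_or_nonempty with rfl | hG
  · simp
  obtain ⟨l, M, hM, hmem⟩ := h.exists_functional hG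
  apply Subset.antisymm
  · intro x hx
    obtain ⟨hxt, hlx⟩ := (hmem x).1 hx
    obtain ⟨w, hw0, hw1, rfl⟩ := Finset.mem_convexHull'.1 hxt
    have hz : ∀ u ∈ t, u ∉ G → w u = 0 := by
      have hsum : ∑ u ∈ t, w u * (M - l u) = 0 := by
        simp only [map_sum, map_smul, smul_eq_mul] at hlx
        simp only [mul_sub, Finset.sum_sub_distrib, hlx, ← Finset.sum_mul, hw1]
        ring
      have hut : ∀ u ∈ t, l u ≤ M := fun u hu => hM u (subset_convexHull ℝ _ hu)
      have := (Finset.sum_eq_zero_iff_of_nonneg fun u hu =>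
        mul_nonneg (hw0 u hu) (sub_nonneg.2 (hut u hu))).1 hsum
      intro u hu huG
      rcases mul_eq_zero.1 (this u hu) with h0 | h0
      · exact h0
      · exact absurd ((hmem u).2 ⟨subset_convexHull ℝ _ hu, by linarith⟩) huG
    refine Finset.mem_convexHull'.2 ⟨w, fun u hu => hw0 u (Finset.mem_filter.1 hu).1, ?_, ?_⟩
    · rw [Finset.sum_filter_of_ne, hw1]
      intro u hu hne
      by_contra hc
      exact hne (hz u hu hc)
    · rw [Finset.sum_filter_of_ne]
      intro u hu hne
      by_contra hc
      exact hne (by rw [hz u hu hc, zero_smul])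
  · apply convexHull_min
    · intro u hu
      exact (Finset.mem_filter.1 hu).2
    · exact IsExposed.convex h (convex_convexHull ℝ _)

theorem IsFace.subset_of_forall_mem {t : Finset E} {G K : Set E}
    (h : IsFace (convexHull ℝ (t : Set E)) G) (hK : Convex ℝ K) (hsub : ∀ u ∈ t, u ∈ G → u ∈ K) :
    G ⊆ K := by
  rw [h.eq_convexHull_filter]
  refine convexHull_min (fun u hu => ?_) hK
  obtain ⟨hut, huG⟩ := Finset.mem_filter.1 hu
  exact hsub u hut huG

theorem finite_faces (t : Finset E) : {G | IsFace (convexHull ℝ (t : Set E)) G}.Finite := by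
  refine (t.powerset.finite_toSet.image fun s : Finset E => convexHull ℝ (s : Set E)).subset ?_
  intro G hG
  exact ⟨t.filter (· ∈ G), Finset.mem_coe.2 (Finset.mem_powerset.2 (Finset.filter_subset _ _)),
    (IsFace.eq_convexHull_filter hG).symm⟩

/-- A face missing a point of the polytope needs fewer generators; this drives the inductions over
faces. -/
theorem filter_ssubset_of_face {t : Finset E} {G : Set E}
    (h : IsFace (convexHull ℝ (t : Set E)) G) {v : E} (hv : v ∈ convexHull ℝ (t : Set E))
    (hvG : v ∉ G) : t.filter (· ∈ G) ⊂ t := by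
  refine (Finset.filter_subset _ _).ssubset_of_ne fun he => hvG ?_
  rw [h.eq_convexHull_filter, he]
  exact hv

/-- If `l` exposes `F` and `m` exposes `G` in `F`, then `r • l + m` exposes `G` once `r` is large. A
single `r` works because only finitely many generators lie outside `F`; exposed faces of general
convex sets are not transitive. -/
theorem IsFace.trans_convexHull {t : Finset E} {F G : Set E}
    (hF : IsFace (convexHull ℝ (t : Set E)) F) (hG : IsFace F G) :
    IsFace (convexHull ℝ (t : Set E)) G := by
  rcases G.eq_empty_or_nonempty with rfl | hGn
  · exact isExposed_empty
  have hFn : F.Nonempty := hGn.mono (IsExposed.subset hG)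
  obtain ⟨l, M, hM, hl⟩ := hF.exists_functional hFn
  obtain ⟨m, N, hN, hm⟩ := hG.exists_functional hGn
  have hut : ∀ u ∈ t, l u ≤ M := fun u hu => hM u (subset_convexHull ℝ _ hu)
  have hev : ∀ᶠ r : ℝ in Filter.atTop, ∀ u ∈ t, u ∉ F → m u - N < r * (M - l u) := by
    rw [Filter.eventually_all_finset]
    intro u hu
    by_cases huF : u ∈ F
    · simp [huF]
    have hpos : 0 < M - l u := by
      refine sub_pos.2 ((hut u hu).lt_of_ne fun he => huF ((hl u).2 ⟨subset_convexHull ℝ _ hu, he⟩))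
    have := (Filter.tendsto_id.atTop_mul_const hpos).eventually_gt_atTop (m u - N)
    filter_upwards [this] with r hr _ using hr
  obtain ⟨r, hr, hr0⟩ := (hev.and (Filter.eventually_gt_atTop 0)).exists
  have hle : ∀ u ∈ t, (r • l + m) u ≤ r * M + N := by
    intro u hu
    simp only [add_apply, smul_apply, smul_eq_mul]
    by_cases huF : u ∈ F
    · have h1 := hN u huF
      have h2 := mul_le_mul_of_nonneg_left (hut u hu) hr0.le
      linarith
    · have := hr u hu huF
      linarith
  have hface : IsFace (convexHull ℝ (t : Set E))
      {x | x ∈ convexHull ℝ (t : Set E) ∧ (r • l + m) x = r * M + N} :=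
    isFace_of_functional (r • l + m) (r * M + N) (fun x hx => le_of_mem_convexHull _ hle hx)
      fun x => Iff.rfl
  convert hface using 1
  apply Subset.antisymm
  · intro x hx
    obtain ⟨hxF, hmx⟩ := (hm x).1 hx
    obtain ⟨hxt, hlx⟩ := (hl x).1 hxF
    exact ⟨hxt, by simp [hlx, hmx]⟩
  · refine hface.subset_of_forall_mem
      (IsExposed.convex hG (IsExposed.convex hF (convex_convexHull ℝ _))) fun u hut' hu => ?_
    obtain ⟨hu2, hu3⟩ := hu
    simp only [add_apply, smul_apply, smul_eq_mul] at hu3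
    have huF : u ∈ F := by
      by_contra huF
      have := hr u hut' huF
      linarith
    refine (hm u).2 ⟨huF, ?_⟩
    have := ((hl u).1 huF).2
    rw [this] at hu3
    linarith

/-- Every ray from a point `v` of a polytope leaves it in a face that does not contain `v`. -/
theorem exists_face_of_ray {t : Finset E} {v x : E}
    (hx : x ∈ convexHull ℝ (t : Set E)) (hxv : x ≠ v) :
    ∃ (y : E) (G : Set E), IsFace (convexHull ℝ (t : Set E)) G ∧ y ∈ G ∧ v ∉ G ∧
      x ∈ segment ℝ v y := by
  set F := convexHull ℝ (t : Set E) with hF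
  have hcomp : IsCompact F := isCompact_convexHull_finset t
  have hconv : Convex ℝ F := convex_convexHull ℝ _
  have hpos : 0 < ‖x - v‖ := norm_pos_iff.2 (sub_ne_zero.2 hxv)
  set K : Set ℝ := {s | v + s • (x - v) ∈ F} with hK
  have hcont : Continuous fun s : ℝ => v + s • (x - v) := by fun_prop
  have hKcl : IsClosed K := hcomp.isClosed.preimage hcont
  obtain ⟨R, hR⟩ := hcomp.isBounded.subset_closedBall v
  have hKb : BddAbove K := by
    refine ⟨R / ‖x - v‖, fun s hs => ?_⟩
    rw [le_div_iff₀ hpos]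
    have := mem_closedBall_iff_norm.1 (hR hs)
    rw [add_sub_cancel_left, norm_smul] at this
    exact (mul_le_mul_of_nonneg_right (le_abs_self s) hpos.le).trans this
  have h1K : (1 : ℝ) ∈ K := by simpa [hK] using hx
  set s := sSup K
  have hsK : s ∈ K := hKcl.csSup_mem ⟨1, h1K⟩ hKb
  have hs1 : 1 ≤ s := le_csSup hKb h1K
  set y := v + s • (x - v) with hy
  have hseg : x ∈ segment ℝ v y := by
    refine ⟨1 - s⁻¹, s⁻¹, sub_nonneg.2 (inv_le_one_of_one_le₀ hs1), by positivity, by ring, ?_⟩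
    rw [hy, smul_add, smul_smul, inv_mul_cancel₀ (by positivity)]
    module
  -- Here `y` is the last point of the ray in `F`. If `y - v` lay in the cone of `F` at `y`, the ray
  -- could be prolonged inside `F`; otherwise the separating functional exposes a face through `y`
  -- that misses `v`.
  rcases farkas t (fun u => u - y) (y - v) with ⟨w, hw, hsum⟩ | ⟨l, hl, hlv⟩
  · exfalso
    set S := ∑ u ∈ t, w u with hS
    have hS0 : 0 ≤ S := Finset.sum_nonneg hw
    -- For `S > 0` this point is the convex combination of `y` and the centre of mass with weights
    -- `w`, taken with coefficients `1 / (1 + S)` and `S / (1 + S)`.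
    have hmem : y + (1 + S)⁻¹ • (y - v) ∈ F := by
      have hin : ∑ u ∈ t, (w u • u) = S • y + (y - v) := by
        rw [← hsum]
        simp only [smul_sub, Finset.sum_sub_distrib, ← Finset.sum_smul, ← hS]
        abel
      rcases hS0.eq_or_lt with h0 | h0
      · have hyv : y - v = 0 := by
          rw [← hsum]
          refine Finset.sum_eq_zero fun u hu => ?_
          rw [(Finset.sum_eq_zero_iff_of_nonneg hw).1 h0.symm u hu, zero_smul]
        rw [hyv, smul_zero, add_zero]
        exact hsK
      · have hc : S⁻¹ • ∑ u ∈ t, (w u • u) ∈ F := by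
          have := t.centerMass_id_mem_convexHull hw h0
          rwa [Finset.centerMass] at this
        have := hconv hsK hc (a := (1 + S)⁻¹) (b := S * (1 + S)⁻¹) (by positivity) (by positivity)
          (by field_simp)
        convert this using 1
        have hk : ((1 + S)⁻¹ + S * (1 + S)⁻¹) • y = y := by
          rw [← one_add_mul, mul_inv_cancel₀ (by positivity), one_smul]
        rw [hin, smul_smul, mul_comm S, mul_assoc, mul_inv_cancel₀ h0.ne', mul_one]
        calc y + (1 + S)⁻¹ • (y - v)
            = ((1 + S)⁻¹ + S * (1 + S)⁻¹) • y + (1 + S)⁻¹ • (y - v) := by rw [hk]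
          _ = (1 + S)⁻¹ • y + (1 + S)⁻¹ • (S • y + (y - v)) := by module
    have hK' : s + (1 + S)⁻¹ * s ∈ K := by
      change v + (s + (1 + S)⁻¹ * s) • (x - v) ∈ F
      convert hmem using 1
      rw [hy]
      module
    have := le_csSup hKb hK'
    have hp : 0 < (1 + S)⁻¹ * s := by positivity
    linarith
  · refine ⟨y, {z | z ∈ F ∧ (-l) z = -l y}, ?_, ⟨hsK, rfl⟩, ?_, hseg⟩
    · refine isFace_of_functional (-l) (-l y) (fun z hz => le_of_mem_convexHull _ ?_ hz)
        fun z => Iff.rfl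
      intro u hu
      have := hl u hu
      simp only [map_sub] at this
      simp only [neg_apply]
      linarith
    · rintro ⟨-, hv⟩
      simp only [neg_apply, map_sub] at hv hlv
      linarith

/-- A face which is maximal among those not containing `v` spans, together with `v`. -/
theorem exists_spanning_face [FiniteDimensional ℝ E] {t : Finset E} {v : E} {G : Set E}
    (hG : IsFace (convexHull ℝ (t : Set E)) G) (hGn : G.Nonempty)
    (hv : v ∈ convexHull ℝ (t : Set E)) (hvG : v ∉ G) :
    ∃ H, IsFace (convexHull ℝ (t : Set E)) H ∧ G ⊆ H ∧ v ∉ H ∧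
      convexHull ℝ (t : Set E) ⊆ affineSpan ℝ (insert v H) := by
  have hfin : {H | IsFace (convexHull ℝ (t : Set E)) H ∧ v ∉ H}.Finite :=
    (finite_faces t).subset fun H hH => hH.1
  obtain ⟨H, hGH, hH⟩ := hfin.exists_le_maximal (a := G) ⟨hG, hvG⟩
  obtain ⟨hHf, hvH⟩ := hH.prop
  refine ⟨H, hHf, hGH, hvH, convexHull_min ?_ (AffineSubspace.convex _)⟩
  by_contra hnot
  obtain ⟨u₀, hu₀, hu₀A⟩ := not_subset.1 hnot
  obtain ⟨l, M, hM, hl⟩ := hHf.exists_functional (hGn.mono hGH)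
  have hvA : v ∈ affineSpan ℝ (insert v H) := subset_affineSpan ℝ _ (mem_insert _ _)
  -- If `v` and `H` do not span, some `g` is constant on both and larger at a generator. Tilting the
  -- functional of `H` by `g` will rotate its supporting hyperplane about `H`.
  have hg : ∃ g : E →L[ℝ] ℝ, (∀ x ∈ H, g x = g v) ∧ g v < g u₀ := by
    have hdir : u₀ -ᵥ v ∉ (affineSpan ℝ (insert v H)).direction := fun h =>
      hu₀A (by simpa using AffineSubspace.vadd_mem_of_mem_direction h hvA)
    obtain ⟨f, hf, hker⟩ := Submodule.exists_le_ker_of_notMem hdir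
    have hfH : ∀ x ∈ H, f x = f v := fun x hx => by
      have := hker (AffineSubspace.vsub_mem_direction
        (subset_affineSpan ℝ _ (mem_insert_of_mem v hx)) hvA)
      rwa [LinearMap.mem_ker, vsub_eq_sub, map_sub, sub_eq_zero] at this
    rw [vsub_eq_sub, map_sub, sub_ne_zero] at hf
    rcases lt_or_gt_of_ne hf with h | h
    · exact ⟨LinearMap.toContinuousLinearMap (-f), fun x hx => by simp [hfH x hx], by simpa using h⟩
    · exact ⟨LinearMap.toContinuousLinearMap f, fun x hx => by simp [hfH x hx], by simpa using h⟩
  obtain ⟨g, hgH, hgu⟩ := hg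
  have hlt : ∀ u ∈ t, g v < g u → l u < M := fun u hu hgv =>
    (hM u (subset_convexHull ℝ _ hu)).lt_of_ne fun he =>
      hgv.ne' (hgH u ((hl u).2 ⟨subset_convexHull ℝ _ hu, he⟩))
  -- The ratio is the amount of tilt at which `u` reaches the hyperplane. At the least one, `u₁`
  -- joins `H` while `v` stays strictly below, which contradicts the maximality of `H`.
  obtain ⟨u₁, hu₁, hmin⟩ := (t.filter fun u => g v < g u).exists_min_image
    (fun u => (M - l u) / (g u - g v)) ⟨u₀, Finset.mem_filter.2 ⟨hu₀, hgu⟩⟩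
  obtain ⟨hu₁t, hgu₁⟩ := Finset.mem_filter.1 hu₁
  set s := (M - l u₁) / (g u₁ - g v) with hs
  have hs0 : 0 < s := div_pos (sub_pos.2 (hlt u₁ hu₁t hgu₁)) (sub_pos.2 hgu₁)
  have hle : ∀ u ∈ t, (l + s • g) u ≤ M + s * g v := by
    intro u hu
    simp only [add_apply, smul_apply, smul_eq_mul]
    rcases lt_or_ge (g v) (g u) with h | h
    · have h1 := hmin u (Finset.mem_filter.2 ⟨hu, h⟩)
      rw [le_div_iff₀ (sub_pos.2 h)] at h1
      linarith
    · have h1 := hM u (subset_convexHull ℝ _ hu)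
      have h2 := mul_le_mul_of_nonneg_left h hs0.le
      linarith
  have hface : IsFace (convexHull ℝ (t : Set E))
      {x | x ∈ convexHull ℝ (t : Set E) ∧ (l + s • g) x = M + s * g v} :=
    isFace_of_functional _ _ (fun x hx => le_of_mem_convexHull _ hle hx) fun x => Iff.rfl
  have hsub := hH.le_of_ge (y := {x | x ∈ convexHull ℝ (t : Set E) ∧ (l + s • g) x = M + s * g v})
    ⟨hface, ?_⟩ ?_
  · have : u₁ ∈ H := by
      refine hsub ⟨subset_convexHull ℝ _ hu₁t, ?_⟩
      have : s * (g u₁ - g v) = M - l u₁ := by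
        rw [hs, div_mul_cancel₀ _ (sub_pos.2 hgu₁).ne']
      simp only [add_apply, smul_apply, smul_eq_mul]
      linarith
    exact hgu₁.ne' (hgH u₁ this)
  · rintro ⟨-, he⟩
    simp only [add_apply, smul_apply, smul_eq_mul] at he
    exact hvH ((hl v).2 ⟨hv, by linarith⟩)
  · intro x hx
    refine ⟨IsExposed.subset hHf hx, ?_⟩
    simp only [add_apply, smul_apply, smul_eq_mul,
      ((hl x).1 hx).2, hgH x hx]

/-! ### Apexes -/

/-- The minimizers of `c` form a compact exposed face, and any extreme point of that face is extreme
in `F`. -/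
theorem exists_isApex (c : E →L[ℝ] ℝ) {F : Set E} (hF : IsCompact F) (hn : F.Nonempty) :
    ∃ v, IsApex c F v := by
  have hexp : IsExposed ℝ F ((-c).toExposed F) := ContinuousLinearMap.toExposed.isExposed
  have hne : ((-c).toExposed F).Nonempty := by
    obtain ⟨x, hx, hmin⟩ := hF.exists_isMinOn hn c.continuous.continuousOn
    exact ⟨x, hx, fun y hy => by simpa using hmin hy⟩
  obtain ⟨v, hv⟩ := (hexp.isCompact hF).extremePoints_nonempty hne
  refine ⟨v, hexp.isExtreme.extremePoints_subset_extremePoints hv, fun y hy => ?_⟩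
  simpa using hv.1.2 y hy

theorem IsApex.mem {c : E →L[ℝ] ℝ} {F : Set E} {v : E} (h : IsApex c F v) : v ∈ F := h.1.1

theorem InGeneralPosition.face {c : E →L[ℝ] ℝ} {F G : Set E} (h : InGeneralPosition c F)
    (hG : IsFace F G) : InGeneralPosition c G :=
  h.mono (IsExposed.isExtreme hG).extremePoints_subset_extremePoints

theorem IsApex.lt {c : E →L[ℝ] ℝ} {F : Set E} {v u : E} (h : InGeneralPosition c F)
    (hv : IsApex c F v) (hu : u ∈ F.extremePoints ℝ) (huv : u ≠ v) : c v < c u :=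
  (hv.2 u hu.1).lt_of_ne fun he => huv (h hu hv.1 he.symm)

/-- The apex of a face is the apex of every smaller face containing it. -/
theorem IsApex.eq_of_mem {c : E →L[ℝ] ℝ} {F G : Set E} {v w : E} (h : InGeneralPosition c F)
    (hv : IsApex c F v) (hG : IsFace F G) (hw : IsApex c G w) (hvG : v ∈ G) : w = v := by
  by_contra hne
  have h1 := hv.lt h ((IsExposed.isExtreme hG).extremePoints_subset_extremePoints hw.1) hne
  exact absurd (hw.2 v hvG) (not_le.2 h1)

/-! ### Barycentric coordinates -/

theorem affineMap_sum_smul {ι : Type*} (f : E →ᵃ[ℝ] ℝ) (s : Finset ι) (w : ι → ℝ) (z : ι → E)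
    (hw : ∑ i ∈ s, w i = 1) : f (∑ i ∈ s, w i • z i) = ∑ i ∈ s, w i * f (z i) := by
  have hf : ∀ x, f x = f.linear x + f 0 := fun x => congrFun f.decomp x
  rw [hf, map_sum]
  simp only [map_smul, smul_eq_mul]
  have h2 : ∑ i ∈ s, w i * f (z i) = ∑ i ∈ s, (w i * f.linear (z i) + w i * f 0) :=
    Finset.sum_congr rfl fun i _ => by rw [hf (z i), mul_add]
  rw [h2, Finset.sum_add_distrib, ← Finset.sum_mul, hw, one_mul]

theorem affineMap_sum_apply {ι : Type*} (s : Finset ι) (f : ι → E →ᵃ[ℝ] ℝ) (x : E) :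
    (∑ i ∈ s, f i) x = ∑ i ∈ s, f i x := by
  induction s using Finset.induction_on with
  | empty => simp
  | insert a s ha ih => rw [Finset.sum_insert ha, Finset.sum_insert ha, ← ih]; rfl

/-- Affine independence of a finite set of points. -/
abbrev AffInd (W : Finset E) : Prop := AffineIndependent ℝ ((↑) : W → E)

theorem AffInd.subset {U W : Finset E} (h : AffInd W) (hU : U ⊆ W) : AffInd U :=
  AffineIndependent.mono (s := (U : Set E)) (t := (W : Set E)) h (by exact_mod_cast hU)

/-- Extending `W` to an affine basis of the whole space makes the coordinates affine functions
defined everywhere, so they can be evaluated outside the simplex. -/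
theorem AffInd.exists_coord {W : Finset E} (h : AffInd W) :
    ∃ b : E → E →ᵃ[ℝ] ℝ, ∀ w ∈ W, ∀ w' ∈ W, b w w' = if w = w' then 1 else 0 := by
  rcases W.eq_empty_or_nonempty with rfl | ⟨w₀, hw₀⟩
  · exact ⟨0, by simp⟩
  obtain ⟨t, hWt, ht, hspan⟩ := exists_subset_affineIndependent_affineSpan_eq_top (k := ℝ)
    (s := (W : Set E)) h
  let B : AffineBasis t ℝ E := ⟨(↑), ht, by simpa using hspan⟩
  refine ⟨fun w => if hw : w ∈ t then B.coord ⟨w, hw⟩ else 0, fun w hw w' hw' => ?_⟩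
  have h1 : w ∈ t := hWt hw
  have h2 : w' ∈ t := hWt hw'
  simp only [h1, dif_pos]
  have := B.coord_apply ⟨w, h1⟩ ⟨w', h2⟩
  rw [show B ⟨w', h2⟩ = w' from rfl] at this
  simpa using this

/-- Affine functions extending the barycentric coordinates of a simplex with vertex set `W`. -/
noncomputable def bary (W : Finset E) : E → E →ᵃ[ℝ] ℝ :=
  if h : AffInd W then h.exists_coord.choose else 0

theorem AffInd.bary_vertex {W : Finset E} (h : AffInd W) {w w' : E} (hw : w ∈ W) (hw' : w' ∈ W) :
    bary W w w' = if w = w' then 1 else 0 := by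
  rw [bary, dif_pos h]
  exact h.exists_coord.choose_spec w hw w' hw'

theorem AffInd.bary_sum_smul {W : Finset E} (h : AffInd W) {μ : E → ℝ} (hμ : ∑ u ∈ W, μ u = 1)
    {w : E} (hw : w ∈ W) : bary W w (∑ u ∈ W, μ u • u) = μ w := by
  rw [affineMap_sum_smul _ _ _ _ hμ]
  rw [Finset.sum_congr rfl fun u hu => by rw [h.bary_vertex hw hu]]
  simp [hw]

theorem exists_weights_of_mem_affineSpan {W : Finset E} {x : E}
    (hx : x ∈ affineSpan ℝ (W : Set E)) :
    ∃ μ : E → ℝ, ∑ u ∈ W, μ u = 1 ∧ ∑ u ∈ W, μ u • u = x := by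
  have hx' : x ∈ affineSpan ℝ (id '' (W : Set E)) := by simpa using hx
  obtain ⟨fs, μ, hfs, hμ, rfl⟩ := eq_affineCombination_of_mem_affineSpan_image hx'
  refine ⟨fun u => if u ∈ fs then μ u else 0, ?_, ?_⟩
  · rw [← Finset.sum_filter, Finset.filter_mem_eq_inter,
      Finset.inter_eq_right.2 (by exact_mod_cast hfs), hμ]
  · simp only [ite_smul, zero_smul]
    rw [← Finset.sum_filter, Finset.filter_mem_eq_inter,
      Finset.inter_eq_right.2 (by exact_mod_cast hfs),
      Finset.affineCombination_eq_linear_combination _ _ _ hμ]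
    rfl

theorem AffInd.sum_bary {W : Finset E} (h : AffInd W) {x : E}
    (hx : x ∈ affineSpan ℝ (W : Set E)) : ∑ w ∈ W, bary W w x = 1 := by
  obtain ⟨μ, hμ, rfl⟩ := exists_weights_of_mem_affineSpan hx
  rw [Finset.sum_congr rfl fun w hw => h.bary_sum_smul hμ hw, hμ]

theorem AffInd.sum_bary_smul {W : Finset E} (h : AffInd W) {x : E}
    (hx : x ∈ affineSpan ℝ (W : Set E)) : ∑ w ∈ W, bary W w x • w = x := by
  obtain ⟨μ, hμ, rfl⟩ := exists_weights_of_mem_affineSpan hx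
  exact Finset.sum_congr rfl fun w hw => by rw [h.bary_sum_smul hμ hw]

theorem AffInd.mem_convexHull_iff {U W : Finset E} (h : AffInd W) (hU : U ⊆ W) {x : E}
    (hx : x ∈ affineSpan ℝ (W : Set E)) :
    x ∈ convexHull ℝ (U : Set E) ↔
      (∀ w ∈ W, 0 ≤ bary W w x) ∧ ∀ w ∈ W, w ∉ U → bary W w x = 0 := by
  constructor
  · intro hxU
    obtain ⟨μ, hμ0, hμ1, rfl⟩ := Finset.mem_convexHull'.1 hxU
    have e1 : ∑ u ∈ W, (if u ∈ U then μ u else 0) = 1 := by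
      rw [← Finset.sum_filter, Finset.filter_mem_eq_inter, Finset.inter_eq_right.2 hU, hμ1]
    have e2 : ∑ u ∈ U, μ u • u = ∑ u ∈ W, (if u ∈ U then μ u else 0) • u := by
      simp only [ite_smul, zero_smul]
      rw [← Finset.sum_filter, Finset.filter_mem_eq_inter, Finset.inter_eq_right.2 hU]
    rw [e2]
    refine ⟨fun w hw => ?_, fun w hw hwU => ?_⟩
    · rw [h.bary_sum_smul e1 hw]
      split_ifs with hwU
      exacts [hμ0 w hwU, le_rfl]
    · rw [h.bary_sum_smul e1 hw, if_neg hwU]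
  · rintro ⟨h0, hz⟩
    refine Finset.mem_convexHull'.2 ⟨fun w => bary W w x, fun w hw => h0 w (hU hw), ?_, ?_⟩
    · rw [Finset.sum_subset hU hz, h.sum_bary hx]
    · rw [Finset.sum_subset hU fun w hw hwU => by simp only [hz w hw hwU, zero_smul], h.sum_bary_smul hx]

theorem mem_affineSpan_of_mem_convexHull {W : Finset E} {x : E}
    (hx : x ∈ convexHull ℝ (W : Set E)) : x ∈ affineSpan ℝ (W : Set E) :=
  convexHull_subset_affineSpan _ hx

theorem AffInd.convexHull_subset_iff {U U' W : Finset E} (h : AffInd W) (hU : U ⊆ W)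
    (hU' : U' ⊆ W) : convexHull ℝ (U : Set E) ⊆ convexHull ℝ (U' : Set E) ↔ U ⊆ U' := by
  refine ⟨fun hs u hu => ?_, fun hs => convexHull_mono (by exact_mod_cast hs)⟩
  by_contra hn
  have h1 := ((h.mem_convexHull_iff hU' (subset_affineSpan ℝ _ (hU hu))).1
    (hs (subset_convexHull ℝ _ hu))).2 u (hU hu) hn
  rw [h.bary_vertex (hU hu) (hU hu)] at h1
  simp at h1

/-! ### Simplices -/

theorem AffInd.isFace_iff [FiniteDimensional ℝ E] {W : Finset E} (h : AffInd W) {F : Set E} :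
    IsFace (convexHull ℝ (W : Set E)) F ↔ ∃ U ⊆ W, F = convexHull ℝ (U : Set E) := by
  constructor
  · intro hF
    exact ⟨W.filter (· ∈ F), Finset.filter_subset _ _, hF.eq_convexHull_filter⟩
  · rintro ⟨U, hU, rfl⟩
    -- On the simplex `f` is at most `0`, with equality exactly when all coordinates outside `U`
    -- vanish. Its linear part therefore exposes the hull of `U` at level `-f 0`.
    let f : E →ᵃ[ℝ] ℝ := -∑ w ∈ W \ U, bary W w
    have hf : ∀ x, f x = -∑ w ∈ W \ U, bary W w x := by
      intro x
      simp only [f, AffineMap.coe_neg, Pi.neg_apply, affineMap_sum_apply]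
    have hdec : ∀ x, f x = f.linear x + f 0 := fun x => congrFun f.decomp x
    refine isFace_of_functional (LinearMap.toContinuousLinearMap f.linear) (-f 0) ?_ ?_
    · intro x hx
      have h0 := ((h.mem_convexHull_iff subset_rfl (mem_affineSpan_of_mem_convexHull hx)).1 hx).1
      have : f x ≤ 0 := by
        rw [hf, neg_nonpos]
        exact Finset.sum_nonneg fun w hw => h0 w (Finset.mem_sdiff.1 hw).1
      rw [hdec] at this
      simpa using (by linarith : f.linear x ≤ -f 0)
    · intro x
      have key : f.linear x = -f 0 ↔ ∑ w ∈ W \ U, bary W w x = 0 := by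
        have h1 := hdec x
        rw [hf x] at h1
        constructor <;> intro h2 <;> linarith
      simp only [LinearMap.coe_toContinuousLinearMap', key]
      constructor
      · intro hx
        have hxW := convexHull_mono (𝕜 := ℝ) (Finset.coe_subset.2 hU) hx
        refine ⟨hxW, Finset.sum_eq_zero fun w hw => ?_⟩
        exact ((h.mem_convexHull_iff hU (mem_affineSpan_of_mem_convexHull hxW)).1 hx).2 w
          (Finset.mem_sdiff.1 hw).1 (Finset.mem_sdiff.1 hw).2
      · rintro ⟨hx, hsum⟩
        have hxA := mem_affineSpan_of_mem_convexHull hx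
        have h0 := ((h.mem_convexHull_iff subset_rfl hxA).1 hx).1
        refine (h.mem_convexHull_iff hU hxA).2 ⟨h0, fun w hw hwU => ?_⟩
        exact (Finset.sum_eq_zero_iff_of_nonneg fun w hw => h0 w (Finset.mem_sdiff.1 hw).1).1 hsum w
          (Finset.mem_sdiff.2 ⟨hw, hwU⟩)

theorem AffInd.hasDim_iff {W : Finset E} (h : AffInd W) {k : ℕ} :
    HasDim (convexHull ℝ (W : Set E)) k ↔ W.card = k + 1 := by
  have hspan : vectorSpan ℝ (convexHull ℝ (W : Set E)) = vectorSpan ℝ (range ((↑) : W → E)) := by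
    rw [← direction_affineSpan, affineSpan_convexHull, direction_affineSpan]
    simp
  rw [HasDim, hspan, convexHull_nonempty_iff]
  constructor
  · rintro ⟨hne, rfl⟩
    have : Nonempty W := Finset.Nonempty.to_subtype (by simpa using hne)
    rw [h.finrank_vectorSpan_add_one, Fintype.card_coe]
  · intro hc
    refine ⟨Finset.card_pos.1 (by omega), h.finrank_vectorSpan (by simpa using hc)⟩

/-! ### Complexes of simplices -/

/-- Vertex sets of the simplices of a geometric simplicial complex. -/
structure IsSimplexFamily (K : Set (Finset E)) : Prop where
  finite : K.Finite
  affInd : ∀ s ∈ K, AffInd s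
  empty_mem : ∅ ∈ K
  down : ∀ s ∈ K, ∀ u ⊆ s, u ∈ K
  inter : ∀ s ∈ K, ∀ t ∈ K, convexHull ℝ (s : Set E) ∩ convexHull ℝ (t : Set E) ⊆
    convexHull ℝ ((s ∩ t : Finset E) : Set E)

/-- The simplices spanned by the members of `K`. -/
def simplices (K : Set (Finset E)) : Set (Set E) :=
  (fun s : Finset E => convexHull ℝ (s : Set E)) '' K

namespace IsSimplexFamily

variable {K : Set (Finset E)}

theorem inter_eq (hK : IsSimplexFamily K) {s t : Finset E} (hs : s ∈ K) (ht : t ∈ K) :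
    convexHull ℝ (s : Set E) ∩ convexHull ℝ (t : Set E) =
      convexHull ℝ ((s ∩ t : Finset E) : Set E) :=
  (hK.inter s hs t ht).antisymm (subset_inter
    (convexHull_mono (by simp)) (convexHull_mono (by simp)))

theorem convexHull_subset_iff (hK : IsSimplexFamily K) {s t : Finset E} (hs : s ∈ K) (ht : t ∈ K) :
    convexHull ℝ (s : Set E) ⊆ convexHull ℝ (t : Set E) ↔ s ⊆ t := by
  rw [← inter_eq_left, hK.inter_eq hs ht]
  constructor
  · intro h
    have := ((hK.affInd s hs).convexHull_subset_iff subset_rfl Finset.inter_subset_left).1 h.ge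
    exact this.trans Finset.inter_subset_right
  · intro h
    rw [Finset.inter_eq_left.2 h]

theorem injOn (hK : IsSimplexFamily K) :
    InjOn (fun s : Finset E => convexHull ℝ (s : Set E)) K := fun _ hs _ ht h =>
  ((hK.convexHull_subset_iff hs ht).1 h.le).antisymm ((hK.convexHull_subset_iff ht hs).1 h.ge)

theorem isPolytopalComplex [FiniteDimensional ℝ E] (hK : IsSimplexFamily K) :
    IsPolytopalComplex (simplices K) where
  finite := hK.finite.image _
  polytope := by
    rintro _ ⟨s, -, rfl⟩
    exact ⟨s, rfl⟩
  empty_mem := ⟨∅, hK.empty_mem, by simp⟩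
  face_mem := by
    rintro _ ⟨s, hs, rfl⟩ G hG
    obtain ⟨u, hu, rfl⟩ := (hK.affInd s hs).isFace_iff.1 hG
    exact ⟨u, hK.down s hs u hu, rfl⟩
  inter_face := by
    rintro _ ⟨s, hs, rfl⟩ _ ⟨t, ht, rfl⟩
    simp only [hK.inter_eq hs ht]
    exact ⟨(hK.affInd s hs).isFace_iff.2 ⟨_, Finset.inter_subset_left, rfl⟩,
      (hK.affInd t ht).isFace_iff.2 ⟨_, Finset.inter_subset_right, rfl⟩⟩

theorem complexFacets_eq (hK : IsSimplexFamily K) :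
    complexFacets (simplices K) = simplices {s | Maximal (· ∈ K) s} := by
  ext F
  constructor
  · rintro ⟨⟨s, hs, rfl⟩, hmax⟩
    exact ⟨s, ⟨hs, fun t ht hst => (hK.convexHull_subset_iff ht hs).1
      (hmax ⟨t, ht, rfl⟩ ((hK.convexHull_subset_iff hs ht).2 hst))⟩, rfl⟩
  · rintro ⟨s, ⟨hs, hmax⟩, rfl⟩
    refine ⟨⟨s, hs, rfl⟩, ?_⟩
    rintro _ ⟨t, ht, rfl⟩ hst
    exact (hK.convexHull_subset_iff ht hs).2 (hmax ht ((hK.convexHull_subset_iff hs ht).1 hst))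

theorem isPureComplex [FiniteDimensional ℝ E] (hK : IsSimplexFamily K) {d : ℕ}
    (hd : ∀ s, Maximal (· ∈ K) s → s.card = d + 1) : IsPureComplex d (simplices K) := by
  refine ⟨hK.isPolytopalComplex, ?_⟩
  rw [hK.complexFacets_eq]
  rintro _ ⟨s, hs, rfl⟩
  exact (hK.affInd s hs.1).hasDim_iff.2 (hd s hs)

end IsSimplexFamily

/-! ### The boundary of a simplex -/

theorem AffInd.isSimplexFamily_ssubset {W : Finset E} (h : AffInd W) (hne : W.Nonempty) :
    IsSimplexFamily {U : Finset E | U ⊂ W} where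
  finite := W.powerset.finite_toSet.subset fun U hU => by simpa using hU.1
  affInd s hs := h.subset hs.1
  empty_mem := Finset.empty_ssubset.2 hne
  down s hs u hu := hu.trans_ssubset hs
  inter s hs t ht := by
    have := h.convexHull_inter (R := ℝ) hs.1 ht.1
    rw [Finset.coe_inter]
    rw [this]

theorem AffInd.boundaryComplex_eq [FiniteDimensional ℝ E] {W : Finset E} (h : AffInd W) :
    boundaryComplex (convexHull ℝ (W : Set E)) = simplices {U : Finset E | U ⊂ W} := by
  ext F
  constructor
  · rintro ⟨hF, hne⟩
    obtain ⟨U, hU, rfl⟩ := h.isFace_iff.1 hF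
    exact ⟨U, hU.ssubset_of_ne (by rintro rfl; exact hne rfl), rfl⟩
  · rintro ⟨U, hU, rfl⟩
    refine ⟨h.isFace_iff.2 ⟨U, hU.1, rfl⟩, fun he => hU.2 ?_⟩
    exact (h.convexHull_subset_iff subset_rfl hU.1).1 he.ge

theorem maximal_ssubset_iff {α : Type*} {W U : Finset α} :
    Maximal (· ∈ {U : Finset α | U ⊂ W}) U ↔ ∃ w ∈ W, U = W.erase w := by
  constructor
  · rintro ⟨hU, hmax⟩
    obtain ⟨w, hw, hwU⟩ := Finset.exists_of_ssubset hU
    refine ⟨w, hw, ?_⟩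
    have h1 : U ⊆ W.erase w := Finset.subset_erase.2 ⟨hU.1, hwU⟩
    exact h1.antisymm (hmax (Finset.erase_ssubset hw) h1)
  · rintro ⟨w, hw, rfl⟩
    refine ⟨Finset.erase_ssubset hw, fun V hV hle => ?_⟩
    obtain ⟨w', hw', hwV⟩ := Finset.exists_of_ssubset hV
    have : w' = w := by
      by_contra hne
      exact hwV (hle (Finset.mem_erase.2 ⟨hne, hw'⟩))
    subst this
    exact Finset.subset_erase.2 ⟨hV.1, hwV⟩

theorem AffInd.inter_erase {W : Finset E} (h : AffInd W) (v w : E) :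
    convexHull ℝ (W.erase v : Set E) ∩ convexHull ℝ (W.erase w : Set E) =
      convexHull ℝ ((W.erase v).erase w : Set E) := by
  have := h.convexHull_inter (R := ℝ) (Finset.erase_subset v W) (Finset.erase_subset w W)
  rw [← this, ← Finset.coe_inter]
  congr 2
  ext u
  simp only [Finset.mem_inter, Finset.mem_erase]
  tauto

theorem AffInd.erase_injOn {W : Finset E} (h : AffInd W) :
    InjOn (fun w => convexHull ℝ (W.erase w : Set E)) W := fun v hv w _ hvw => by
  by_contra hne
  have := (h.convexHull_subset_iff (Finset.erase_subset w W) (Finset.erase_subset v W)).1 hvw.ge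
  exact Finset.notMem_erase v W (this (Finset.mem_erase.2 ⟨hne, hv⟩))

theorem AffInd.facets_boundary [FiniteDimensional ℝ E] {n : ℕ} {W : Finset E} (h : AffInd W)
    (e : Fin (n + 2) → E) (he : Function.Injective e) (hr : Finset.univ.image e = W) :
    IsPureComplex n (boundaryComplex (convexHull ℝ (W : Set E))) ∧
      Function.Injective (fun i => convexHull ℝ (W.erase (e i) : Set E)) ∧
      range (fun i => convexHull ℝ (W.erase (e i) : Set E)) =
        complexFacets (boundaryComplex (convexHull ℝ (W : Set E))) := by
  have hmem : ∀ i, e i ∈ W := fun i => hr ▸ Finset.mem_image_of_mem e (Finset.mem_univ i)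
  have hcard : W.card = n + 2 := by
    rw [← hr, Finset.card_image_of_injective _ he, Finset.card_univ, Fintype.card_fin]
  have hK := h.isSimplexFamily_ssubset ⟨_, hmem 0⟩
  rw [h.boundaryComplex_eq]
  refine ⟨hK.isPureComplex fun s hs => ?_, fun i j hij => ?_, ?_⟩
  · obtain ⟨w, hw, rfl⟩ := maximal_ssubset_iff.1 hs
    rw [Finset.card_erase_of_mem hw, hcard]
    rfl
  · exact he (h.erase_injOn (hmem i) (hmem j) hij)
  · rw [hK.complexFacets_eq]
    ext F
    constructor
    · rintro ⟨i, rfl⟩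
      exact ⟨W.erase (e i), maximal_ssubset_iff.2 ⟨e i, hmem i, rfl⟩, rfl⟩
    · rintro ⟨U, hU, rfl⟩
      obtain ⟨w, hw, rfl⟩ := maximal_ssubset_iff.1 hU
      rw [← hr] at hw
      obtain ⟨i, -, rfl⟩ := Finset.mem_image.1 hw
      exact ⟨i, rfl⟩

/-- Every ordering of the facets of a simplex is a shelling of its boundary complex. -/
theorem AffInd.isShelling_boundary [FiniteDimensional ℝ E] (n : ℕ) {W : Finset E} (h : AffInd W)
    (e : Fin (n + 2) → E) (he : Function.Injective e) (hr : Finset.univ.image e = W) :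
    IsShelling n (boundaryComplex (convexHull ℝ (W : Set E))) (n + 2)
      fun i => convexHull ℝ (W.erase (e i) : Set E) := by
  induction n generalizing W with
  | zero => exact h.facets_boundary e he hr
  | succ n ih =>
    have hmem : ∀ i, e i ∈ W := fun i => hr ▸ Finset.mem_image_of_mem e (Finset.mem_univ i)
    -- Dropping `e j` from the enumeration keeps the order of the other vertices, so the ridges
    -- shared with earlier facets are the first `j` facets of the facet opposite to `e j`.
    have hsub := fun j : Fin (n + 3) => ih (h.subset (Finset.erase_subset (e j) W))
      (e ∘ j.succAbove) (he.comp Fin.succAbove_right_injective) (by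
        ext u
        simp only [Finset.mem_image, Finset.mem_univ, true_and, Finset.mem_erase, ← hr,
          Function.comp_apply]
        constructor
        · rintro ⟨i, rfl⟩
          exact ⟨fun hc => Fin.succAbove_ne j i (he hc), j.succAbove i, rfl⟩
        · rintro ⟨hne, i, rfl⟩
          obtain ⟨k, rfl⟩ := Fin.exists_succAbove_eq (x := i) (y := j)
            (by rintro rfl; exact hne rfl)
          exact ⟨k, rfl⟩)
    refine ⟨h.facets_boundary e he hr, fun j _ => ⟨_, _, hsub j⟩, fun j hj => ?_⟩
    have hinter : earlierInter (fun i => convexHull ℝ (W.erase (e i) : Set E)) j =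
        ⋃ i : Fin (n + 2), ⋃ _ : (i : ℕ) < j,
          convexHull ℝ ((W.erase (e j)).erase ((e ∘ j.succAbove) i) : Set E) := by
      ext x
      simp only [earlierInter, mem_inter_iff, mem_iUnion, exists_prop, Function.comp_apply]
      constructor
      · rintro ⟨hxj, i, hij, hxi⟩
        refine ⟨⟨i, by omega⟩, hij, ?_⟩
        rw [Fin.succAbove_of_castSucc_lt _ _ hij, ← h.inter_erase]
        exact ⟨hxj, hxi⟩
      · rintro ⟨i, hij, hx⟩
        rw [Fin.succAbove_of_castSucc_lt _ _ hij, ← h.inter_erase] at hx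
        exact ⟨hx.1, _, hij, hx.2⟩
    refine ⟨?_, _, _, hsub j, j, by omega, hinter⟩
    rw [hinter]
    refine ⟨e (j.succAbove 1), mem_iUnion₂.2 ⟨0, hj, subset_convexHull ℝ _ ?_⟩⟩
    simp [hmem, he.eq_iff, Fin.succAbove_ne]

/-! ### Auxiliary facts on barycentric coordinates -/

theorem apply_lineMap_real (f : E →ᵃ[ℝ] ℝ) (x y : E) (r : ℝ) :
    f (AffineMap.lineMap x y r) = (1 - r) * f x + r * f y := by
  rw [AffineMap.apply_lineMap, AffineMap.lineMap_apply_module, smul_eq_mul, smul_eq_mul]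

theorem lineMap_mem_of_convex {P : Set E} (hP : Convex ℝ P) {x y : E} (hx : x ∈ P) (hy : y ∈ P)
    {r : ℝ} (h0 : 0 ≤ r) (h1 : r ≤ 1) : AffineMap.lineMap x y r ∈ P :=
  hP.lineMap_mem hx hy ⟨h0, h1⟩

theorem eventually_mem_Ioo_zero_one : ∀ᶠ r : ℝ in nhdsWithin 0 (Ioi 0), 0 < r ∧ r < 1 :=
  Ioo_mem_nhdsGT one_pos

theorem eventually_lineMap_pos (f : E →ᵃ[ℝ] ℝ) {x : E} (y : E) (hx : 0 < f x) :
    ∀ᶠ r : ℝ in nhdsWithin 0 (Ioi 0), 0 < f (AffineMap.lineMap x y r) := by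
  have hc : Continuous fun r : ℝ => f (AffineMap.lineMap x y r) := by
    simp only [apply_lineMap_real]
    fun_prop
  have : ∀ᶠ r : ℝ in nhds 0, 0 < f (AffineMap.lineMap x y r) :=
    hc.continuousAt.eventually (lt_mem_nhds (by simpa using hx))
  exact this.filter_mono nhdsWithin_le_nhds

/-- Finitely many affine functions, none of which vanishes on the convex set `P`, have a common
point of `P` where none of them vanishes. -/
theorem exists_forall_ne_zero {P : Set E} (hP : Convex ℝ P) (hne : P.Nonempty)
    (S : Finset (E →ᵃ[ℝ] ℝ)) (hS : ∀ f ∈ S, ∃ p ∈ P, f p ≠ 0) : ∃ q ∈ P, ∀ f ∈ S, f q ≠ 0 := by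
  induction S using Finset.induction_on with
  | empty => exact ⟨hne.some, hne.some_mem, by simp⟩
  | insert f S hf ih =>
    obtain ⟨q, hq, hqS⟩ := ih fun g hg => hS g (Finset.mem_insert_of_mem hg)
    by_cases hfq : f q = 0
    · obtain ⟨p, hp, hfp⟩ := hS f (Finset.mem_insert_self _ _)
      have hev : ∀ᶠ r : ℝ in nhdsWithin 0 (Ioi 0), ∀ g ∈ S, g (AffineMap.lineMap q p r) ≠ 0 := by
        rw [Filter.eventually_all_finset]
        intro g hg
        rcases lt_or_gt_of_ne (hqS g hg) with h | h
        · filter_upwards [eventually_lineMap_pos (-g) p (x := q) (by simpa using h)] with r hr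
          simp only [AffineMap.coe_neg, Pi.neg_apply] at hr
          linarith
        · filter_upwards [eventually_lineMap_pos g p h] with r hr using hr.ne'
      obtain ⟨r, hr, hr0, hr1⟩ := (hev.and eventually_mem_Ioo_zero_one).exists
      refine ⟨_, lineMap_mem_of_convex hP hq hp hr0.le hr1.le, fun g hg => ?_⟩
      rcases Finset.mem_insert.1 hg with rfl | hg
      · rw [apply_lineMap_real, hfq, mul_zero, zero_add]
        exact mul_ne_zero hr0.ne' hfp
      · exact hr g hg
    · refine ⟨q, hq, fun g hg => ?_⟩
      rcases Finset.mem_insert.1 hg with rfl | hg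
      exacts [hfq, hqS g hg]

theorem AffInd.exists_pos_bary {U W : Finset E} (h : AffInd W) (hU : U ⊆ W) (hne : U.Nonempty) :
    ∃ y ∈ convexHull ℝ (U : Set E), ∀ u ∈ U, 0 < bary W u y := by
  have hcard : (0 : ℝ) < U.card := by exact_mod_cast hne.card_pos
  have e1 : ∑ u ∈ W, (if u ∈ U then (U.card : ℝ)⁻¹ else 0) = 1 := by
    rw [← Finset.sum_filter, Finset.filter_mem_eq_inter, Finset.inter_eq_right.2 hU,
      Finset.sum_const, nsmul_eq_mul, mul_inv_cancel₀ hcard.ne']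
  refine ⟨∑ u ∈ W, (if u ∈ U then (U.card : ℝ)⁻¹ else 0) • u, ?_, fun u hu => ?_⟩
  · simp only [ite_smul, zero_smul]
    rw [← Finset.sum_filter, Finset.filter_mem_eq_inter, Finset.inter_eq_right.2 hU]
    refine Finset.mem_convexHull'.2 ⟨fun _ => (U.card : ℝ)⁻¹, fun _ _ => by positivity, ?_, rfl⟩
    rw [Finset.sum_const, nsmul_eq_mul, mul_inv_cancel₀ hcard.ne']
  · rw [h.bary_sum_smul e1 (hU hu), if_pos hu]
    positivity

theorem AffInd.subset_of_pos_bary {U U' W : Finset E} (h : AffInd W) (hU : U ⊆ W) (hU' : U' ⊆ W)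
    {y : E} (hy : ∀ u ∈ U, 0 < bary W u y) (hyU' : y ∈ convexHull ℝ (U' : Set E)) : U ⊆ U' := by
  intro u hu
  by_contra hn
  have hyW := convexHull_mono (𝕜 := ℝ) (Finset.coe_subset.2 hU') hyU'
  exact (hy u hu).ne' (((h.mem_convexHull_iff hU' (mem_affineSpan_of_mem_convexHull hyW)).1
    hyU').2 u (hU hu) hn)

theorem AffInd.mem_erase_iff {W : Finset E} (h : AffInd W) {w x : E} (hw : w ∈ W)
    (hx : x ∈ convexHull ℝ (W : Set E)) :
    x ∈ convexHull ℝ (W.erase w : Set E) ↔ bary W w x = 0 := by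
  have hxA := mem_affineSpan_of_mem_convexHull hx
  rw [h.mem_convexHull_iff (Finset.erase_subset w W) hxA]
  constructor
  · rintro ⟨-, h0⟩
    exact h0 w hw (Finset.notMem_erase w W)
  · intro h0
    refine ⟨((h.mem_convexHull_iff subset_rfl hxA).1 hx).1, fun u hu hne => ?_⟩
    rwa [show u = w by simpa [hu] using hne]

/-! ### Regular triangulations -/

/-- The affine function that agrees with `ht` at the vertices of `W`. -/
noncomputable def height (ht : E → ℝ) (W : Finset E) : E →ᵃ[ℝ] ℝ := ∑ w ∈ W, ht w • bary W w

theorem height_apply (ht : E → ℝ) (W : Finset E) (x : E) :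
    height ht W x = ∑ w ∈ W, bary W w x * ht w := by
  simp only [height, affineMap_sum_apply, AffineMap.coe_smul, Pi.smul_apply, smul_eq_mul, mul_comm]

theorem AffInd.height_vertex {W : Finset E} (h : AffInd W) (ht : E → ℝ) {w : E} (hw : w ∈ W) :
    height ht W w = ht w := by
  rw [height_apply, Finset.sum_congr rfl fun u hu => by rw [h.bary_vertex hu hw]]
  simp [hw]

/-- The facets of a triangulation of a `d`-dimensional convex set `P` without new
vertices which is regular with heights `ht`. -/
structure IsRegularFamily (P : Set E) (d : ℕ) (T : Finset (Finset E)) (ht : E → ℝ) : Prop where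
  convex : Convex ℝ P
  nonempty : P.Nonempty
  affInd : ∀ W ∈ T, AffInd W
  card : ∀ W ∈ T, W.card = d + 1
  extreme : ∀ W ∈ T, ∀ w ∈ W, w ∈ P.extremePoints ℝ
  span : ∀ W ∈ T, P ⊆ affineSpan ℝ (W : Set E)
  cover : ∀ x ∈ P, ∃ W ∈ T, x ∈ convexHull ℝ (W : Set E)
  lt : ∀ W ∈ T, ∀ W' ∈ T, ∀ v ∈ W', v ∉ W → ht v < height ht W v

/-- The subsets of the members of `T`. -/
def subfaces (T : Finset (Finset E)) : Set (Finset E) := {U | ∃ W ∈ T, U ⊆ W}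

namespace IsRegularFamily

variable {P : Set E} {d : ℕ} {T : Finset (Finset E)} {ht : E → ℝ}

theorem convexHull_subset (h : IsRegularFamily P d T ht) {W : Finset E} (hW : W ∈ T) :
    convexHull ℝ (W : Set E) ⊆ P :=
  convexHull_min (fun w hw => (h.extreme W hW w hw).1) h.convex

theorem le_height (h : IsRegularFamily P d T ht) {W W' : Finset E} (hW : W ∈ T) (hW' : W' ∈ T)
    {v : E} (hv : v ∈ W') : ht v ≤ height ht W v := by
  by_cases hvW : v ∈ W
  · rw [(h.affInd W hW).height_vertex ht hvW]
  · exact (h.lt W hW W' hW' v hv hvW).le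

theorem height_eq_sum (h : IsRegularFamily P d T ht) {W W' : Finset E} (hW' : W' ∈ T) {x : E}
    (hx : x ∈ P) : height ht W x = ∑ v ∈ W', bary W' v x * height ht W v := by
  have h1 := h.affInd W' hW'
  have hA := h.span W' hW' hx
  conv_lhs => rw [← h1.sum_bary_smul hA]
  rw [affineMap_sum_smul _ _ _ _ (h1.sum_bary hA)]

/-- The inequality holds at the vertices of `W'` and passes to their convex combinations: on its own
simplex an interpolant is minimal. -/
theorem height_le (h : IsRegularFamily P d T ht) {W W' : Finset E} (hW : W ∈ T) (hW' : W' ∈ T)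
    {x : E} (hx : x ∈ convexHull ℝ (W' : Set E)) : height ht W' x ≤ height ht W x := by
  rw [h.height_eq_sum (W := W) hW' (h.convexHull_subset hW' hx), height_apply]
  refine Finset.sum_le_sum fun v hv => mul_le_mul_of_nonneg_left (h.le_height hW hW' hv) ?_
  exact (((h.affInd W' hW').mem_convexHull_iff subset_rfl
    (mem_affineSpan_of_mem_convexHull hx)).1 hx).1 v hv

/-- Equality of the two weighted sums forces equality term by term, so vertices of `W'` outside `W`,
where the inequality is strict, have weight zero. -/
theorem mem_inter_of_height_eq (h : IsRegularFamily P d T ht) {W W' : Finset E} (hW : W ∈ T)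
    (hW' : W' ∈ T) {x : E} (hx : x ∈ convexHull ℝ (W' : Set E))
    (heq : height ht W' x = height ht W x) : x ∈ convexHull ℝ ((W' ∩ W : Finset E) : Set E) := by
  have h1 := h.affInd W' hW'
  have hA := mem_affineSpan_of_mem_convexHull hx
  have h0 := ((h1.mem_convexHull_iff subset_rfl hA).1 hx).1
  rw [h.height_eq_sum (W := W) hW' (h.convexHull_subset hW' hx), height_apply] at heq
  refine (h1.mem_convexHull_iff Finset.inter_subset_left hA).2 ⟨h0, fun v hv hvn => ?_⟩
  have hvW : v ∉ W := fun hc => hvn (Finset.mem_inter.2 ⟨hv, hc⟩)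
  have := (Finset.sum_eq_sum_iff_of_le fun v hv =>
    mul_le_mul_of_nonneg_left (h.le_height hW hW' hv) (h0 v hv)).1 heq v hv
  by_contra hne
  exact (h.lt W hW W' hW' v hv hvW).ne (mul_left_cancel₀ hne this)

theorem height_lt (h : IsRegularFamily P d T ht) {W W' : Finset E} (hW : W ∈ T) (hW' : W' ∈ T)
    {x : E} (hx : x ∈ convexHull ℝ (W' : Set E)) (hxW : x ∉ convexHull ℝ (W : Set E)) :
    height ht W' x < height ht W x :=
  (h.height_le hW hW' hx).lt_of_ne fun heq => hxW
    (convexHull_mono (by simp) (h.mem_inter_of_height_eq hW hW' hx heq))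

theorem height_eq (h : IsRegularFamily P d T ht) {W W' : Finset E} (hW : W ∈ T) (hW' : W' ∈ T)
    {x : E} (hx : x ∈ convexHull ℝ (W : Set E)) (hx' : x ∈ convexHull ℝ (W' : Set E)) :
    height ht W x = height ht W' x :=
  (h.height_le hW' hW hx).antisymm (h.height_le hW hW' hx')

theorem mem_inter (h : IsRegularFamily P d T ht) {W W' : Finset E} (hW : W ∈ T) (hW' : W' ∈ T)
    {x : E} (hx : x ∈ convexHull ℝ (W : Set E)) (hx' : x ∈ convexHull ℝ (W' : Set E)) :
    x ∈ convexHull ℝ ((W ∩ W' : Finset E) : Set E) :=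
  h.mem_inter_of_height_eq hW' hW hx (h.height_eq hW hW' hx hx')

theorem isSimplexFamily (h : IsRegularFamily P d T ht) : IsSimplexFamily (subfaces T) where
  finite := by
    refine (T.biUnion Finset.powerset).finite_toSet.subset ?_
    rintro U ⟨W, hW, hU⟩
    exact Finset.mem_coe.2 (Finset.mem_biUnion.2 ⟨W, hW, Finset.mem_powerset.2 hU⟩)
  affInd := by
    rintro U ⟨W, hW, hU⟩
    exact (h.affInd W hW).subset hU
  empty_mem := by
    obtain ⟨x, hx⟩ := h.nonempty
    obtain ⟨W, hW, -⟩ := h.cover x hx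
    exact ⟨W, hW, Finset.empty_subset W⟩
  down := by
    rintro U ⟨W, hW, hU⟩ V hV
    exact ⟨W, hW, hV.trans hU⟩
  inter := by
    rintro U ⟨W, hW, hU⟩ U' ⟨W', hW', hU'⟩ x ⟨hx, hx'⟩
    have h1 := h.mem_inter hW hW' (convexHull_mono (Finset.coe_subset.2 hU) hx)
      (convexHull_mono (Finset.coe_subset.2 hU') hx')
    -- Hulls may be intersected vertexwise only inside one affinely independent set, so `U` is
    -- handled inside `W` and then `U'` inside `W'`.
    have h2 : x ∈ convexHull ℝ ((U : Set E) ∩ (W ∩ W' : Finset E)) := by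
      rw [(h.affInd W hW).convexHull_inter hU Finset.inter_subset_left]
      exact ⟨hx, h1⟩
    rw [← Finset.coe_inter] at h2
    have h3 : x ∈ convexHull ℝ ((U' : Set E) ∩ (U ∩ (W ∩ W') : Finset E)) := by
      rw [(h.affInd W' hW').convexHull_inter hU'
        (Finset.inter_subset_right.trans Finset.inter_subset_right)]
      exact ⟨hx', h2⟩
    refine convexHull_mono ?_ h3
    rw [← Finset.coe_inter, Finset.coe_subset]
    intro u hu
    simp only [Finset.mem_inter] at hu ⊢
    tauto

theorem maximal_iff (h : IsRegularFamily P d T ht) {U : Finset E} :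
    Maximal (· ∈ subfaces T) U ↔ U ∈ T := by
  constructor
  · rintro ⟨⟨W, hW, hU⟩, hmax⟩
    have : W ⊆ U := hmax ⟨W, hW, subset_rfl⟩ hU
    rwa [hU.antisymm this]
  · intro hU
    refine ⟨⟨U, hU, subset_rfl⟩, ?_⟩
    rintro V ⟨W, hW, hV⟩ hUV
    have := Finset.eq_of_subset_of_card_le (hUV.trans hV) (by rw [h.card W hW, h.card U hU])
    rw [this]
    exact hV

theorem isPureComplex [FiniteDimensional ℝ E] (h : IsRegularFamily P d T ht) :
    IsPureComplex d (simplices (subfaces T)) :=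
  h.isSimplexFamily.isPureComplex fun s hs => h.card s (h.maximal_iff.1 hs)

theorem complexFacets_eq (h : IsRegularFamily P d T ht) :
    complexFacets (simplices (subfaces T)) = simplices T := by
  rw [h.isSimplexFamily.complexFacets_eq]
  congr 1
  ext U
  exact h.maximal_iff

theorem isTriangulation [FiniteDimensional ℝ E] (h : IsRegularFamily P d T ht) :
    IsTriangulation P (simplices (subfaces T)) := by
  refine ⟨h.isSimplexFamily.isPolytopalComplex, ?_, ?_⟩
  · rintro _ ⟨s, hs, rfl⟩
    exact ⟨s, h.isSimplexFamily.affInd s hs, rfl⟩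
  · apply Subset.antisymm
    · rintro x ⟨_, ⟨s, ⟨W, hW, hs⟩, rfl⟩, hx⟩
      exact h.convexHull_subset hW (convexHull_mono (Finset.coe_subset.2 hs) hx)
    · intro x hx
      obtain ⟨W, hW, hxW⟩ := h.cover x hx
      exact ⟨_, ⟨W, ⟨W, hW, subset_rfl⟩, rfl⟩, hxW⟩

/-! ### The shelling seen from a generic point -/

theorem exists_generic (h : IsRegularFamily P d T ht) :
    ∃ q ∈ P, InjOn (fun W => height ht W q) T := by
  obtain ⟨q, hq, hne⟩ := exists_forall_ne_zero h.convex h.nonempty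
    (T.offDiag.image fun p => height ht p.1 - height ht p.2) (by
      intro f hf
      obtain ⟨⟨W, W'⟩, hp, rfl⟩ := Finset.mem_image.1 hf
      obtain ⟨hW, hW', hne⟩ := Finset.mem_offDiag.1 hp
      have hnot : ¬ W' ⊆ W := fun hs => hne
        (Finset.eq_of_subset_of_card_le hs (by rw [h.card W hW, h.card W' hW'])).symm
      obtain ⟨v, hv, hvW⟩ := Finset.not_subset.1 hnot
      refine ⟨v, (h.extreme W' hW' v hv).1, ?_⟩
      have h1 := h.lt W hW W' hW' v hv hvW
      have h2 := (h.affInd W' hW').height_vertex ht hv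
      simp only [AffineMap.coe_sub, Pi.sub_apply]
      linarith)
  refine ⟨q, hq, fun W hW W' hW' heq => ?_⟩
  by_contra hWW
  refine hne _ (Finset.mem_image_of_mem _ (a := (W, W'))
    (Finset.mem_offDiag.2 ⟨hW, hW', hWW⟩)) ?_
  simpa [sub_eq_zero] using heq

/-- The vertices of `W` opposite to the facets that are visible from `q`. -/
noncomputable def _root_.PointedTriangulation.visible (q : E) (W : Finset E) : Finset E :=
  W.filter fun w => bary W w q < 0

/-- If `x` were on no visible facet, a short move towards `q` would stay in the simplex of `W`,
where the height of `W` is minimal. But the two heights agree at `x` and that of `W'` is smaller at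
`q`, hence also just after `x`. -/
theorem mem_visible_of_lower (h : IsRegularFamily P d T ht) {q : E} (hq : q ∈ P) {W W' : Finset E}
    (hW : W ∈ T) (hW' : W' ∈ T) (hlt : height ht W' q < height ht W q) {x : E}
    (hx : x ∈ convexHull ℝ (W : Set E)) (hx' : x ∈ convexHull ℝ (W' : Set E)) :
    ∃ w ∈ visible q W, x ∈ convexHull ℝ (W.erase w : Set E) := by
  by_contra! hcon
  have hA := h.affInd W hW
  have hxP := h.convexHull_subset hW hx
  have h0 := ((hA.mem_convexHull_iff subset_rfl (h.span W hW hxP)).1 hx).1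
  have hev : ∀ᶠ r : ℝ in nhdsWithin 0 (Ioi 0), ∀ w ∈ W,
      0 ≤ bary W w (AffineMap.lineMap x q r) := by
    rw [Filter.eventually_all_finset]
    intro w hw
    rcases lt_or_ge (bary W w q) 0 with hwq | hwq
    · have hne := hcon w (Finset.mem_filter.2 ⟨hw, hwq⟩)
      rw [hA.mem_erase_iff hw hx] at hne
      filter_upwards [eventually_lineMap_pos (bary W w) q ((h0 w hw).lt_of_ne' hne)] with r hr
        using hr.le
    · filter_upwards [eventually_mem_Ioo_zero_one] with r hr
      rw [apply_lineMap_real]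
      have := mul_nonneg (sub_nonneg.2 hr.2.le) (h0 w hw)
      have := mul_nonneg hr.1.le hwq
      linarith
  obtain ⟨r, hr, hr0, hr1⟩ := (hev.and eventually_mem_Ioo_zero_one).exists
  have hzP := lineMap_mem_of_convex h.convex hxP hq hr0.le hr1.le
  have hz : AffineMap.lineMap x q r ∈ convexHull ℝ (W : Set E) :=
    (hA.mem_convexHull_iff subset_rfl (h.span W hW hzP)).2 ⟨hr, fun w hw hn => absurd hw hn⟩
  have h1 := h.height_le hW' hW hz
  rw [apply_lineMap_real, apply_lineMap_real, h.height_eq hW hW' hx hx'] at h1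
  have := mul_lt_mul_of_pos_left hlt hr0
  linarith

/-- Moving from a relative interior point `y` of a visible facet towards `q` leaves `W` at once, and
some `W'` contains points of this path arbitrarily close to `y`. It contains `y` by closedness,
hence the whole facet. The height of `W'` is smaller just after `y` and equal at `y`, so it is
smaller at `q`. -/
theorem exists_lower_of_visible (h : IsRegularFamily P d T ht) {q : E} (hq : q ∈ P) {W : Finset E}
    (hW : W ∈ T) {w : E} (hw : w ∈ visible q W) :
    ∃ W' ∈ T, height ht W' q < height ht W q ∧ W.erase w ⊆ W' := by
  obtain ⟨hwW, hwq⟩ := Finset.mem_filter.1 hw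
  have hA := h.affInd W hW
  -- If `w` were the only vertex, its coordinate at `q` would be `1`, not negative.
  have hne : (W.erase w).Nonempty := by
    by_contra hemp
    rw [Finset.not_nonempty_iff_eq_empty] at hemp
    have := hA.sum_bary (h.span W hW hq)
    rw [← Finset.add_sum_erase _ _ hwW, hemp, Finset.sum_empty] at this
    linarith
  obtain ⟨y, hy, hpos⟩ := hA.exists_pos_bary (Finset.erase_subset w W) hne
  have hyW := convexHull_mono (𝕜 := ℝ) (Finset.coe_subset.2 (Finset.erase_subset w W)) hy
  have hyP := h.convexHull_subset hW hyW
  have hyw := (hA.mem_erase_iff hwW hyW).1 hy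
  have hfreq : ∃ W' ∈ T, ∃ᶠ r : ℝ in nhdsWithin 0 (Ioi 0),
      AffineMap.lineMap y q r ∈ convexHull ℝ (W' : Set E) := by
    by_contra! hcon
    have : ∀ᶠ r : ℝ in nhdsWithin 0 (Ioi 0), ∀ W' ∈ T,
        AffineMap.lineMap y q r ∉ convexHull ℝ (W' : Set E) := by
      rw [Filter.eventually_all_finset]
      exact fun W' hW' => hcon W' hW'
    obtain ⟨r, hr, hr0, hr1⟩ := (this.and eventually_mem_Ioo_zero_one).exists
    obtain ⟨W', hW', hmem⟩ := h.cover _ (lineMap_mem_of_convex h.convex hyP hq hr0.le hr1.le)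
    exact hr W' hW' hmem
  obtain ⟨W', hW', hfr⟩ := hfreq
  have hcont : Continuous fun r : ℝ => (AffineMap.lineMap y q r : E) :=
    AffineMap.lineMap_continuous
  have hyW' : y ∈ convexHull ℝ (W' : Set E) := by
    have := (isCompact_convexHull_finset W').isClosed.mem_of_frequently_of_tendsto hfr
      (hcont.continuousAt.tendsto.mono_left nhdsWithin_le_nhds)
    simpa using this
  obtain ⟨r, hz, hr0, hr1⟩ := (hfr.and_eventually eventually_mem_Ioo_zero_one).exists
  have hzW : AffineMap.lineMap y q r ∉ convexHull ℝ (W : Set E) := fun hc => by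
    have := ((hA.mem_convexHull_iff subset_rfl (mem_affineSpan_of_mem_convexHull hc)).1 hc).1 w hwW
    rw [apply_lineMap_real, hyw, mul_zero, zero_add] at this
    have := mul_neg_of_pos_of_neg hr0 hwq
    linarith
  have h1 := h.height_lt hW hW' hz hzW
  rw [apply_lineMap_real, apply_lineMap_real, h.height_eq hW' hW hyW' hyW] at h1
  refine ⟨W', hW', lt_of_mul_lt_mul_left (by linarith) hr0.le, ?_⟩
  exact (hA.subset_of_pos_bary (Finset.erase_subset w W) Finset.inter_subset_left hpos
    (h.mem_inter hW hW' hyW hyW')).trans Finset.inter_subset_right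

theorem visible_nonempty (h : IsRegularFamily P d T ht) {q : E} (hq : q ∈ P) {W W' : Finset E}
    (hW : W ∈ T) (hW' : W' ∈ T) (hlt : height ht W' q < height ht W q) :
    (visible q W).Nonempty := by
  by_contra hemp
  rw [Finset.not_nonempty_iff_eq_empty] at hemp
  have hqW : q ∈ convexHull ℝ (W : Set E) := by
    refine ((h.affInd W hW).mem_convexHull_iff subset_rfl (h.span W hW hq)).2
      ⟨fun w hw => ?_, fun w hw hn => absurd hw hn⟩
    by_contra hc
    exact Finset.notMem_empty w (hemp ▸ Finset.mem_filter.2 ⟨hw, not_le.1 hc⟩)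
  exact absurd (h.height_le hW' hW hqW) (not_le.2 hlt)

theorem card_visible_lt (h : IsRegularFamily P d T ht) {q : E} (hq : q ∈ P) {W : Finset E}
    (hW : W ∈ T) (hne : (visible q W).Nonempty) : (visible q W).card < d := by
  have hA := h.affInd W hW
  have hqA := h.span W hW hq
  have hsub : visible q W ⊆ W := Finset.filter_subset _ _
  by_contra! hcard
  have hneg : ∀ v ∈ visible q W, bary W v q < 0 := fun v hv => (Finset.mem_filter.1 hv).2
  have hss : visible q W ≠ W := fun he => by
    have h1 := hA.sum_bary hqA
    have h2 : ∑ w ∈ W, bary W w q ≤ 0 :=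
      Finset.sum_nonpos fun w hw => (hneg w (he.symm ▸ hw)).le
    linarith
  obtain ⟨w, hw, hwV⟩ := Finset.exists_of_ssubset (hsub.ssubset_of_ne hss)
  have hWV : insert w (visible q W) = W := by
    refine Finset.eq_of_subset_of_card_le (Finset.insert_subset hw hsub) ?_
    rw [Finset.card_insert_of_notMem hwV, h.card W hW]
    omega
  set σ := ∑ v ∈ visible q W, -bary W v q with hσ
  have hσ0 : 0 < σ := Finset.sum_pos (fun v hv => neg_pos.2 (hneg v hv)) hne
  have hwq : bary W w q = 1 + σ := by
    have h1 := hA.sum_bary hqA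
    have h2 : ∑ u ∈ W, bary W u q = ∑ u ∈ insert w (visible q W), bary W u q := by rw [hWV]
    rw [h2, Finset.sum_insert hwV] at h1
    rw [hσ, Finset.sum_neg_distrib]
    linarith
  -- Moving the negative terms of `q` to the other side gives `q + σ p = (1 + σ) w`, with `p` in the
  -- facet opposite to `w`.
  set p := σ⁻¹ • ∑ v ∈ visible q W, (-bary W v q) • v with hp
  have hpP : p ∈ P := by
    refine h.convexHull_subset hW (convexHull_mono (Finset.coe_subset.2 hsub) ?_)
    exact (visible q W).centerMass_id_mem_convexHull (fun v hv => (neg_pos.2 (hneg v hv)).le) hσ0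
  have hdec : q + σ • p = (1 + σ) • w := by
    have h1 := hA.sum_bary_smul hqA
    have h2 : ∑ u ∈ W, bary W u q • u = ∑ u ∈ insert w (visible q W), bary W u q • u := by
      rw [hWV]
    rw [h2, Finset.sum_insert hwV, hwq] at h1
    rw [hp, smul_smul, mul_inv_cancel₀ hσ0.ne', one_smul]
    simp only [neg_smul, Finset.sum_neg_distrib]
    rw [← sub_eq_add_neg, sub_eq_iff_eq_add]
    exact h1.symm
  have hseg : w ∈ openSegment ℝ q p := by
    refine ⟨(1 + σ)⁻¹, (1 + σ)⁻¹ * σ, by positivity, by positivity, ?_, ?_⟩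
    · rw [← mul_one_add, inv_mul_cancel₀ (by positivity)]
    · rw [mul_smul, ← smul_add, hdec, smul_smul, inv_mul_cancel₀ (by positivity), one_smul]
  have hqw : q = w := (h.extreme W hW w hw).2 hq hpP hseg
  obtain ⟨v, hv⟩ := hne
  have h1 := hneg v hv
  rw [hqw, hA.bary_vertex (hsub hv) hw] at h1
  split_ifs at h1 <;> linarith

end IsRegularFamily

/-! ### Enumerations, and the shelling of a regular triangulation -/

/-- A finite set can be enumerated in the order of an injective real function. -/
theorem exists_sorted_enumeration {α : Type*} (T : Finset α) (f : α → ℝ) (hf : InjOn f T) :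
    ∃ (s : ℕ) (a : Fin s → α), range a = T ∧ ∀ i j, f (a i) < f (a j) ↔ i < j := by
  let o := (T.image f).orderEmbOfFin rfl
  have ho : ∀ i, ∃ x ∈ T, f x = o i := fun i =>
    Finset.mem_image.1 ((T.image f).orderEmbOfFin_mem rfl i)
  choose a ha hfa using ho
  refine ⟨_, a, Subset.antisymm ?_ ?_, fun i j => ?_⟩
  · rintro _ ⟨i, rfl⟩
    exact ha i
  · intro x hx
    have hx' : f x ∈ range o := by
      rw [Finset.range_orderEmbOfFin]
      exact_mod_cast Finset.mem_image_of_mem f hx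
    obtain ⟨i, hi⟩ := hx'
    exact ⟨i, hf (ha i) hx ((hfa i).trans hi)⟩
  · rw [hfa, hfa, OrderEmbedding.lt_iff_lt]

/-- A finite set can be enumerated with the elements of a given subset first. -/
theorem exists_enumeration_subset_first {α : Type*} {V W : Finset α} (hV : V ⊆ W) {n : ℕ}
    (hn : W.card = n) :
    ∃ e : Fin n → α, Function.Injective e ∧ Finset.univ.image e = W ∧
      ∀ i, e i ∈ V ↔ (i : ℕ) < V.card := by
  have hlen : (V.toList ++ (W \ V).toList).length = n := by
    rw [List.length_append, Finset.length_toList, Finset.length_toList, 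
      Finset.card_sdiff_of_subset hV, ← hn]
    have := Finset.card_le_card hV
    omega
  have hnd : (V.toList ++ (W \ V).toList).Nodup := by
    refine List.Nodup.append V.nodup_toList (W \ V).nodup_toList fun x hx hx' => ?_
    rw [Finset.mem_toList] at hx hx'
    exact (Finset.mem_sdiff.1 hx').2 hx
  refine ⟨fun i => (V.toList ++ (W \ V).toList)[(i : ℕ)]'(by rw [hlen]; exact i.2), ?_, ?_, ?_⟩
  · intro i j hij
    exact Fin.ext ((hnd.getElem_inj_iff).1 hij)
  · ext x
    simp only [Finset.mem_image, Finset.mem_univ, true_and]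
    have hx : x ∈ W ↔ x ∈ V.toList ++ (W \ V).toList := by
      simp only [List.mem_append, Finset.mem_toList, Finset.mem_sdiff]
      constructor
      · tauto
      · rintro (h | h)
        exacts [hV h, h.1]
    rw [hx, List.mem_iff_getElem]
    constructor
    · rintro ⟨i, rfl⟩
      exact ⟨i, by rw [hlen]; exact i.2, rfl⟩
    · rintro ⟨i, hi, rfl⟩
      exact ⟨⟨i, by rwa [hlen] at hi⟩, rfl⟩
  · intro i
    beta_reduce
    rw [List.getElem_append]
    split_ifs with hi
    · rw [Finset.length_toList] at hi
      simp only [hi, iff_true]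
      exact Finset.mem_toList.1 (List.getElem_mem _)
    · rw [Finset.length_toList] at hi
      simp only [hi, iff_false]
      have := Finset.mem_toList.1 (List.getElem_mem (l := (W \ V).toList)
        (n := (i : ℕ) - V.toList.length) (by
          have h1 := i.2
          rw [List.length_append] at hlen
          rw [Finset.length_toList] at hlen ⊢
          omega))
      exact (Finset.mem_sdiff.1 this).2

/-- The facets of a `d`-simplex contained in the union of some of its facets. -/
theorem AffInd.setOf_facets_subset [FiniteDimensional ℝ E] {V W : Finset E} (h : AffInd W)
    (hV : V ⊆ W) {d : ℕ} (hd : W.card = d + 2) :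
    {F : Set E | IsFacet (d + 1) (convexHull ℝ (W : Set E)) F ∧
        F ⊆ {x | ∃ w ∈ V, x ∈ convexHull ℝ (W.erase w : Set E)}} =
      (fun w => convexHull ℝ (W.erase w : Set E)) '' V := by
  ext F
  constructor
  · rintro ⟨⟨hF, k, hk, hdim⟩, hsub⟩
    obtain ⟨U, hU, rfl⟩ := h.isFace_iff.1 hF
    have hcard := (h.subset hU).hasDim_iff.1 hdim
    -- A facet inside a union of facets is one of them: the facet of the union that contains a
    -- relative interior point contains the whole facet, and cardinalities agree.
    obtain ⟨y, hy, hpos⟩ := h.exists_pos_bary hU (Finset.card_pos.1 (by omega))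
    obtain ⟨w, hw, hyw⟩ := hsub hy
    have hUw := h.subset_of_pos_bary hU (Finset.erase_subset w W) hpos hyw
    refine ⟨w, hw, ?_⟩
    rw [Finset.eq_of_subset_of_card_le hUw]
    rw [Finset.card_erase_of_mem (hV hw)]
    omega
  · rintro ⟨w, hw, rfl⟩
    refine ⟨⟨h.isFace_iff.2 ⟨_, Finset.erase_subset w W, rfl⟩, d, rfl, ?_⟩, fun x hx => ⟨w, hw, hx⟩⟩
    rw [(h.subset (Finset.erase_subset w W)).hasDim_iff, Finset.card_erase_of_mem (hV hw), hd]
    rfl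

/-- Ordering by height at a generic `q` turns the intersection with earlier simplices into the union
of the visible facets, so both the shelling condition and the overlap count become statements about
`visible q`. -/
theorem IsRegularFamily.exists_shelling [FiniteDimensional ℝ E] {P : Set E} {d : ℕ}
    {T : Finset (Finset E)} {ht : E → ℝ} (h : IsRegularFamily P d T ht) :
    ∃ (s : ℕ) (α : Fin s → Set E), IsShelling d (simplices (subfaces T)) s α ∧
      ∀ j : Fin s, 0 < (j : ℕ) → 1 ≤ overlapCount d α j ∧ overlapCount d α j ≤ d - 1 := by
  obtain ⟨q, hq, hinj⟩ := h.exists_generic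
  obtain ⟨s, a, hrange, hlt⟩ := exists_sorted_enumeration T (fun W => height ht W q) hinj
  have haT : ∀ i, a i ∈ T := fun i => by
    have := mem_range_self (f := a) i
    rwa [hrange] at this
  let α : Fin s → Set E := fun i => convexHull ℝ (a i : Set E)
  have hbasic : IsPureComplex d (simplices (subfaces T)) ∧ Function.Injective α ∧
      range α = complexFacets (simplices (subfaces T)) := by
    refine ⟨h.isPureComplex, fun i j hij => ?_, ?_⟩
    · have hij' : a i = a j := h.isSimplexFamily.injOn ⟨_, haT i, subset_rfl⟩
        ⟨_, haT j, subset_rfl⟩ hij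
      have h1 := hlt i j
      have h2 := hlt j i
      rw [hij', lt_self_iff_false, false_iff, not_lt] at h1 h2
      exact le_antisymm h2 h1
    · rw [h.complexFacets_eq, simplices, ← hrange, ← range_comp]
      rfl
  have hinter : ∀ j, earlierInter α j =
      {x | ∃ w ∈ visible q (a j), x ∈ convexHull ℝ ((a j).erase w : Set E)} := by
    intro j
    ext x
    simp only [earlierInter, mem_inter_iff, mem_iUnion, exists_prop, mem_ofPred_eq]
    constructor
    · rintro ⟨hx, i, hij, hxi⟩
      exact h.mem_visible_of_lower hq (haT j) (haT i) ((hlt i j).2 hij) hx hxi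
    · rintro ⟨w, hw, hx⟩
      refine ⟨convexHull_mono (Finset.coe_subset.2 (Finset.erase_subset _ _)) hx, ?_⟩
      obtain ⟨W', hW', hlow, hsub⟩ := h.exists_lower_of_visible hq (haT j) hw
      obtain ⟨i, rfl⟩ : W' ∈ range a := by rw [hrange]; exact hW'
      exact ⟨i, (hlt i j).1 hlow, convexHull_mono (Finset.coe_subset.2 hsub) hx⟩
  have hvis : ∀ j : Fin s, 0 < (j : ℕ) → (visible q (a j)).Nonempty := fun j hj =>
    h.visible_nonempty hq (haT j) (haT ⟨0, hj.trans j.2⟩) ((hlt _ _).2 (Fin.lt_def.2 hj))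
  have hVsub : ∀ j, visible q (a j) ⊆ a j := fun j => Finset.filter_subset _ _
  refine ⟨s, α, ?_, fun j hj => ?_⟩
  · cases d with
    | zero => exact hbasic
    | succ n =>
      have hshell : ∀ j, ∃ e : Fin (n + 2) → E,
          (∀ i, e i ∈ visible q (a j) ↔ (i : ℕ) < (visible q (a j)).card) ∧
          Finset.univ.image e = a j ∧ IsShelling n (boundaryComplex (α j)) (n + 2)
            fun i => convexHull ℝ ((a j).erase (e i) : Set E) := by
        intro j
        obtain ⟨e, he, hr, hV⟩ := exists_enumeration_subset_first (hVsub j) (h.card _ (haT j))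
        exact ⟨e, hV, hr, (h.affInd _ (haT j)).isShelling_boundary n e he hr⟩
      refine ⟨hbasic, fun j _ => ?_, fun j hj => ⟨?_, ?_⟩⟩
      · obtain ⟨e, -, -, he⟩ := hshell j
        exact ⟨_, _, he⟩
      · rw [hinter]
        obtain ⟨w, hw⟩ := hvis j hj
        have hpos : 0 < ((a j).erase w).card := by
          rw [Finset.card_erase_of_mem (hVsub j hw), h.card _ (haT j)]
          omega
        obtain ⟨u, hu⟩ := Finset.card_pos.1 hpos
        exact ⟨u, w, hw, subset_convexHull ℝ _ hu⟩
      · obtain ⟨e, hV, hr, he⟩ := hshell j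
        refine ⟨_, _, he, (visible q (a j)).card, ?_, ?_⟩
        · exact (Finset.card_le_card (hVsub j)).trans (h.card _ (haT j)).le
        · rw [hinter]
          ext x
          simp only [mem_ofPred_eq, mem_iUnion, exists_prop]
          constructor
          · rintro ⟨w, hw, hx⟩
            have hw' := hVsub j hw
            rw [← hr] at hw'
            obtain ⟨i, -, rfl⟩ := Finset.mem_image.1 hw'
            exact ⟨i, (hV i).1 hw, hx⟩
          · rintro ⟨i, hi, hx⟩
            exact ⟨e i, (hV i).2 hi, hx⟩
  · have hpos := (hvis j hj).card_pos
    have hcard := h.card_visible_lt hq (haT j) (hvis j hj)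
    have hcount : overlapCount d α j = (visible q (a j)).card := by
      obtain ⟨n, rfl⟩ : ∃ n, d = n + 1 := ⟨d - 1, by omega⟩
      have hA := h.affInd _ (haT j)
      rw [overlapCount, hinter, hA.setOf_facets_subset (hVsub j) (h.card _ (haT j)),
        (hA.erase_injOn.mono (Finset.coe_subset.2 (hVsub j))).ncard_image,
        ncard_coe_finset]
    omega

/-! ### Flags -/

/-- `W` is the set of apexes of a complete flag of faces of `F`, each of which does not contain the
apex of the preceding one and spans it together with that apex. -/
inductive IsFlag (c : E →L[ℝ] ℝ) : Set E → Finset E → Prop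
  | point (v : E) : IsFlag c {v} {v}
  | cone {F G : Set E} {v : E} {W : Finset E} (hG : IsFace F G) (hv : IsApex c F v) (hvG : v ∉ G)
      (hspan : F ⊆ affineSpan ℝ (insert v G)) (hW : IsFlag c G W) : IsFlag c F (insert v W)

namespace IsFlag

variable {c : E →L[ℝ] ℝ} {F : Set E} {W : Finset E}

theorem nonempty (h : IsFlag c F W) : W.Nonempty := by
  cases h <;> simp

theorem extreme (h : IsFlag c F W) : ∀ w ∈ W, w ∈ F.extremePoints ℝ := by
  induction h with
  | point v => simp
  | cone hG hv hvG hspan hW ih =>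
    intro w hw
    rcases Finset.mem_insert.1 hw with rfl | hw
    · exact hv.1
    · exact (IsExposed.isExtreme hG).extremePoints_subset_extremePoints (ih w hw)

theorem subset (h : IsFlag c F W) : (W : Set E) ⊆ F := fun w hw => (h.extreme w hw).1

theorem carrier_nonempty (h : IsFlag c F W) : F.Nonempty :=
  (Finset.coe_nonempty.2 h.nonempty).mono h.subset

theorem span (h : IsFlag c F W) : F ⊆ affineSpan ℝ (W : Set E) := by
  induction h with
  | point v => simp
  | @cone F G v W hG hv hvG hspan hW ih =>
    refine hspan.trans (affineSpan_le.2 ?_)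
    rw [Finset.coe_insert]
    refine insert_subset (subset_affineSpan ℝ _ (mem_insert _ _)) (ih.trans ?_)
    exact affineSpan_mono ℝ (subset_insert _ _)

/-- A nonempty face of `F` contains all points of `F` in its affine span. -/
theorem _root_.PointedTriangulation.IsFace.mem_of_mem_affineSpan {F G : Set E} (hG : IsFace F G)
    (hne : G.Nonempty) {x : E} (hx : x ∈ F) (hxG : x ∈ affineSpan ℝ G) : x ∈ G := by
  obtain ⟨l, M, -, hmem⟩ := hG.exists_functional hne
  refine (hmem x).2 ⟨hx, ?_⟩
  have h2 : affineSpan ℝ G ≤ (AffineSubspace.mk' M (⊥ : Submodule ℝ ℝ)).comap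
      (l : E →ₗ[ℝ] ℝ).toAffineMap := by
    rw [affineSpan_le]
    intro y hy
    simp [((hmem y).1 hy).2]
  simpa [sub_eq_zero] using h2 hxG

theorem affInd (h : IsFlag c F W) : AffInd W := by
  induction h with
  | point v =>
    exact affineIndependent_of_subsingleton ℝ _
  | @cone F G v W hG hv hvG hspan hW ih =>
    have hmem : v ∈ insert v W := Finset.mem_insert_self v W
    refine AffineIndependent.affineIndependent_of_notMem_span (i := ⟨v, hmem⟩) ?_ ?_
    · let f : {y : (insert v W : Finset E) // y ≠ ⟨v, hmem⟩} ↪ W :=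
        ⟨fun y => ⟨y, (Finset.mem_insert.1 y.1.2).resolve_left fun h => y.2 (Subtype.ext h)⟩,
          fun y z hyz => Subtype.ext (Subtype.ext (congrArg (fun u : W => (u : E)) hyz))⟩
      exact ih.comp_embedding f
    · intro hc
      refine hvG (hG.mem_of_mem_affineSpan hW.carrier_nonempty hv.mem (affineSpan_mono ℝ ?_ hc))
      rintro _ ⟨y, hy, rfl⟩
      exact hW.subset ((Finset.mem_insert.1 y.2).resolve_left fun h => hy (Subtype.ext h))

/-- The regularity of the family of all flags. -/
theorem exists_weights (h : IsFlag c F W) (hc : InGeneralPosition c F) {v : E}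
    (hv : v ∈ F.extremePoints ℝ) (hvW : v ∉ W) :
    ∃ (w : E) (μ : E → ℝ), w ∈ W ∧ c w < c v ∧ ∑ u ∈ W, μ u = 1 ∧ ∑ u ∈ W, μ u • u = v ∧
      0 < μ w ∧ ∀ u ∈ W, c u < c w → μ u = 0 := by
  induction h with
  | point u => simp_all
  | @cone F G a W hG ha haG hspan hW ih =>
    have haW : a ∉ W := fun hc => haG (hW.subset hc)
    by_cases hvG : v ∈ G
    · obtain ⟨w, μ, hw, hcw, hμ1, hμv, hpos, hz⟩ := ih (hc.face hG)
        (inter_extremePoints_subset_extremePoints_of_subset (IsExposed.subset hG) ⟨hvG, hv⟩)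
        fun h => hvW (Finset.mem_insert_of_mem h)
      have hupd : ∀ u ∈ W, Function.update μ a 0 u = μ u := fun u hu =>
        Function.update_of_ne (by rintro rfl; exact haW hu) _ _
      refine ⟨w, Function.update μ a 0, Finset.mem_insert_of_mem hw, hcw, ?_, ?_, ?_, ?_⟩
      · rw [Finset.sum_insert haW, Function.update_self, zero_add, Finset.sum_congr rfl hupd, hμ1]
      · rw [Finset.sum_insert haW, Function.update_self, zero_smul, zero_add, ← hμv]
        exact Finset.sum_congr rfl fun u hu => by rw [hupd u hu]
      · rwa [hupd w hw]
      · intro u hu hlt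
        rcases Finset.mem_insert.1 hu with rfl | hu
        · simp
        · rw [hupd u hu, hz u hu hlt]
    · have hva : v ≠ a := fun h => hvW (h ▸ Finset.mem_insert_self _ _)
      obtain ⟨μ, hμ1, hμv⟩ := exists_weights_of_mem_affineSpan
        ((IsFlag.cone hG ha haG hspan hW).span hv.1)
      refine ⟨a, μ, Finset.mem_insert_self _ _, ha.lt hc hv hva, hμ1, hμv, ?_, ?_⟩
      · obtain ⟨l, M, hM, hmem⟩ := hG.exists_functional hW.carrier_nonempty
        have hla : l a < M := (hM a ha.mem).lt_of_ne fun h => haG ((hmem a).2 ⟨ha.mem, h⟩)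
        have hlv : l v < M := (hM v hv.1).lt_of_ne fun h => hvG ((hmem v).2 ⟨hv.1, h⟩)
        rw [Finset.sum_insert haW] at hμ1 hμv
        have h1 : l v = μ a * l a + (∑ u ∈ W, μ u) * M := by
          rw [← hμv, map_add, map_smul, map_sum, Finset.sum_mul]
          congr 1
          refine Finset.sum_congr rfl fun u hu => ?_
          rw [map_smul, ((hmem u).1 (hW.subset hu)).2, smul_eq_mul]
        have h2 : μ a * (M - l a) = M - l v := by
          linear_combination h1 + M * hμ1
        by_contra hn
        have := mul_nonpos_of_nonpos_of_nonneg (not_lt.1 hn) (sub_pos.2 hla).le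
        linarith
      · intro u hu hlt
        rcases Finset.mem_insert.1 hu with rfl | hu
        · exact absurd hlt (lt_irrefl _)
        · exact absurd (ha.2 u (IsExposed.subset hG (hW.subset hu))) (not_le.2 hlt)

end IsFlag

/-- The ray from `v` through `x ≠ v` leaves a polytope in a face which spans it together with `v`. -/
theorem exists_spanning_face_of_ne [FiniteDimensional ℝ E] {t : Finset E} {v x : E}
    (hv : v ∈ convexHull ℝ (t : Set E)) (hx : x ∈ convexHull ℝ (t : Set E)) (hxv : x ≠ v) :
    ∃ (y : E) (H : Set E), IsFace (convexHull ℝ (t : Set E)) H ∧ y ∈ H ∧ v ∉ H ∧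
      convexHull ℝ (t : Set E) ⊆ affineSpan ℝ (insert v H) ∧ x ∈ segment ℝ v y := by
  obtain ⟨y, G, hG, hyG, hvG, hseg⟩ := exists_face_of_ray (v := v) hx hxv
  obtain ⟨H, hH, hGH, hvH, hspan⟩ := exists_spanning_face hG ⟨y, hyG⟩ hv hvG
  exact ⟨y, H, hH, hGH hyG, hvH, hspan, hseg⟩

/-- The simplices of the flags cover the polytope. -/
theorem exists_isFlag_mem [FiniteDimensional ℝ E] (c : E →L[ℝ] ℝ) (t : Finset E) :
    ∀ x ∈ convexHull ℝ (t : Set E), ∃ W, IsFlag c (convexHull ℝ (t : Set E)) W ∧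
      x ∈ convexHull ℝ (W : Set E) := by
  induction t using Finset.strongInduction with
  | H t ih =>
    intro x hx
    obtain ⟨v, hv⟩ := exists_isApex c (isCompact_convexHull_finset t) ⟨x, hx⟩
    by_cases hsing : convexHull ℝ (t : Set E) = {v}
    · refine ⟨{v}, hsing ▸ IsFlag.point v, ?_⟩
      rw [hsing] at hx
      simpa using hx
    have hstep : ∀ z ∈ convexHull ℝ (t : Set E), z ≠ v → ∃ W,
        IsFlag c (convexHull ℝ (t : Set E)) W ∧ v ∈ W ∧ z ∈ convexHull ℝ (W : Set E) := by
      intro z hz hzv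
      obtain ⟨y, H, hH, hyH, hvH, hspan, hseg⟩ := exists_spanning_face_of_ne hv.mem hz hzv
      have heq := hH.eq_convexHull_filter
      obtain ⟨W, hW, hyW⟩ := ih _ (filter_ssubset_of_face hH hv.mem hvH) y (heq ▸ hyH)
      rw [← heq] at hW
      refine ⟨insert v W, .cone hH hv hvH hspan hW, Finset.mem_insert_self _ _, ?_⟩
      refine (convex_convexHull ℝ _).segment_subset ?_ ?_ hseg
      · exact subset_convexHull ℝ _ (Finset.mem_insert_self _ _)
      · exact convexHull_mono (Finset.coe_subset.2 (Finset.subset_insert _ _)) hyW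
    by_cases hxv : x = v
    · obtain ⟨z, hz, hzv⟩ : ∃ z ∈ convexHull ℝ (t : Set E), z ≠ v := by
        by_contra! hcon
        exact hsing (Subset.antisymm hcon (singleton_subset_iff.2 hv.mem))
      obtain ⟨W, hW, hvW, -⟩ := hstep z hz hzv
      exact ⟨W, hW, subset_convexHull ℝ _ (hxv ▸ hvW)⟩
    · obtain ⟨W, hW, -, hxW⟩ := hstep x hx hxv
      exact ⟨W, hW, hxW⟩

/-! ### Chains of faces -/

/-- `U` is the set of apexes of a chain of faces of `F`, each of which does not contain the apex of
the preceding one. -/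
inductive IsApexChain (c : E →L[ℝ] ℝ) : Set E → Set E → Prop
  | nil (F : Set E) : IsApexChain c F ∅
  | cons {F G A : Set E} {v : E} {U : Set E} (hG : IsFace F G) (hv : IsApex c G v)
      (hA : IsFace G A) (hvA : v ∉ A) (hU : IsApexChain c A U) : IsApexChain c F (insert v U)

theorem isApexChain_of_fin {c : E →L[ℝ] ℝ} {F : Set E} (k : ℕ) (G : Fin k → Set E) (v : Fin k → E)
    (h1 : ∀ i, IsFace F (G i) ∧ (G i).Nonempty ∧ IsApex c (G i) (v i))
    (h2 : ∀ i j, i < j → G j ⊂ G i ∧ v i ∉ G j) : IsApexChain c F (range v) := by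
  induction k generalizing F with
  | zero =>
    rw [range_eq_empty]
    exact .nil F
  | succ k ih =>
    have hr : range v = insert (v 0) (range (Fin.tail v)) := by
      conv_lhs => rw [← Fin.cons_self_tail v, Fin.range_cons]
    rw [hr]
    have htail : ∀ A : Set E, (∀ i : Fin k, IsFace A (G i.succ)) →
        IsApexChain c A (range (Fin.tail v)) := fun A hA =>
      ih (Fin.tail G) (Fin.tail v) (fun i => ⟨hA i, (h1 i.succ).2⟩)
        fun i j hij => h2 i.succ j.succ (Fin.succ_lt_succ_iff.2 hij)
    cases k with
    | zero => exact .cons (h1 0).1 (h1 0).2.2 isExposed_empty (notMem_empty _) (htail ∅ finZeroElim)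
    | succ k =>
      have h01 := h2 0 1 (by simp)
      refine .cons (h1 0).1 (h1 0).2.2
        (IsExposed.mono (h1 1).1 (IsExposed.subset (h1 0).1) h01.1.1) h01.2 (htail (G 1) ?_)
      intro i
      refine IsExposed.mono (h1 i.succ).1 (IsExposed.subset (h1 1).1) ?_
      rcases Fin.eq_zero_or_eq_succ i with rfl | ⟨i, rfl⟩
      · exact subset_rfl
      · exact (h2 1 _ (by rw [← Fin.succ_zero_eq_one, Fin.succ_lt_succ_iff]; exact Fin.succ_pos i)).1.1

/-- Every chain can be refined to a complete flag. -/
theorem IsApexChain.exists_isFlag [FiniteDimensional ℝ E] {c : E →L[ℝ] ℝ} (t : Finset E)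
    (hne : (convexHull ℝ (t : Set E)).Nonempty)
    (hc : InGeneralPosition c (convexHull ℝ (t : Set E))) {U : Set E}
    (hU : IsApexChain c (convexHull ℝ (t : Set E)) U) :
    ∃ W, IsFlag c (convexHull ℝ (t : Set E)) W ∧ U ⊆ (W : Set E) := by
  induction t using Finset.strongInduction generalizing U with
  | H t ih =>
    obtain ⟨v, hv⟩ := exists_isApex c (isCompact_convexHull_finset t) hne
    have hsub : ∀ {F U : Set E}, IsApexChain c F U → U ⊆ F := by
      intro F U h
      induction h with
      | nil F => exact empty_subset F
      | cons hG hv hA hvA hU ih =>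
        exact (insert_subset hv.mem (ih.trans (IsExposed.subset hA))).trans (IsExposed.subset hG)
    by_cases hsing : convexHull ℝ (t : Set E) = {v}
    · refine ⟨{v}, hsing ▸ IsFlag.point v, ?_⟩
      rw [Finset.coe_singleton, ← hsing]
      exact hsub hU
    have hstep : ∀ (A : Set E) (U' : Set E), IsFace (convexHull ℝ (t : Set E)) A → v ∉ A →
        IsApexChain c A U' → ∃ W, IsFlag c (convexHull ℝ (t : Set E)) W ∧
          insert v U' ⊆ (W : Set E) := by
      intro A U' hA hvA hU'
      obtain ⟨H, hH, hHne, hAH, hvH, hspan⟩ : ∃ H, IsFace (convexHull ℝ (t : Set E)) H ∧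
          H.Nonempty ∧ A ⊆ H ∧ v ∉ H ∧ convexHull ℝ (t : Set E) ⊆ affineSpan ℝ (insert v H) := by
        rcases A.eq_empty_or_nonempty with rfl | hAne
        · obtain ⟨z, hz, hzv⟩ : ∃ z ∈ convexHull ℝ (t : Set E), z ≠ v := by
            by_contra! hcon
            exact hsing (Subset.antisymm hcon (singleton_subset_iff.2 hv.mem))
          obtain ⟨y, H, hH, hyH, hvH, hspan, -⟩ := exists_spanning_face_of_ne hv.mem hz hzv
          exact ⟨H, hH, ⟨y, hyH⟩, empty_subset H, hvH, hspan⟩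
        · obtain ⟨H, hH, hAH, hvH, hspan⟩ := exists_spanning_face hA hAne hv.mem hvA
          exact ⟨H, hH, hAne.mono hAH, hAH, hvH, hspan⟩
      have heq := hH.eq_convexHull_filter
      have hUH : IsApexChain c H U' := by
        cases hU' with
        | nil => exact .nil H
        | cons hG hv hB hvB hU =>
          refine .cons ?_ hv hB hvB hU
          have hGt := hA.trans_convexHull hG
          exact IsExposed.mono hGt (IsExposed.subset hH) ((IsExposed.subset hG).trans hAH)
      obtain ⟨W, hW, hUW⟩ := ih _ (filter_ssubset_of_face hH hv.mem hvH) (heq ▸ hHne)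
        (heq ▸ hc.face hH) (heq ▸ hUH)
      rw [← heq] at hW
      refine ⟨insert v W, .cone hH hv hvH hspan hW, ?_⟩
      rw [Finset.coe_insert]
      exact insert_subset_insert hUW
    cases hU with
    | nil =>
      obtain ⟨W, hW, -⟩ := hstep ∅ ∅ isExposed_empty (notMem_empty v) (.nil ∅)
      exact ⟨W, hW, empty_subset _⟩
    | @cons _ G A w U hG hw hA hwA hU =>
      by_cases hvG : v ∈ G
      · obtain rfl := hv.eq_of_mem hc hG hw hvG
        exact hstep A U (hG.trans_convexHull hA) hwA hU
      · obtain ⟨W, hW, hsubW⟩ := hstep G (insert w U) hG hvG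
          (.cons (IsExposed.refl G) hw hA hwA hU)
        exact ⟨W, hW, (subset_insert _ _).trans hsubW⟩

/-- Every subset of a complete flag comes from a chain of faces. -/
theorem IsFlag.exists_fin {c : E →L[ℝ] ℝ} {t : Finset E} {F : Set E} {W : Finset E}
    (hW : IsFlag c F W) (hF : IsFace (convexHull ℝ (t : Set E)) F) {U : Finset E} (hU : U ⊆ W) :
    ∃ (k : ℕ) (G : Fin k → Set E) (v : Fin k → E),
      (∀ i, IsFace (convexHull ℝ (t : Set E)) (G i) ∧ (G i).Nonempty ∧ IsApex c (G i) (v i)) ∧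
      (∀ i j, i < j → G j ⊂ G i ∧ v i ∉ G j) ∧ (∀ i, G i ⊆ F) ∧ range v = (U : Set E) := by
  induction hW generalizing U with
  | point u =>
    rcases Finset.subset_singleton_iff.1 hU with rfl | rfl
    · exact ⟨0, finZeroElim, finZeroElim, finZeroElim, finZeroElim, finZeroElim, by simp⟩
    · refine ⟨1, fun _ => {u}, fun _ => u, fun _ => ⟨hF, singleton_nonempty u, ?_⟩, ?_,
        fun _ => subset_rfl, by simp⟩
      · exact ⟨by simp, by simp⟩
      · intro i j hij
        omega
  | @cone F G a W hG ha haG hspan hW ih =>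
    have haW : a ∉ W := fun hc => haG (hW.subset hc)
    by_cases haU : a ∈ U
    · obtain ⟨k, G', v, h1, h2, h3, h4⟩ := ih (hF.trans_convexHull hG) (U := U.erase a)
        (by rwa [← Finset.subset_insert_iff])
      refine ⟨k + 1, Fin.cons F G', Fin.cons a v, ?_, ?_, ?_, ?_⟩
      · refine Fin.cases ⟨hF, ⟨a, ha.mem⟩, ha⟩ ?_
        simpa using h1
      · refine Fin.cases (Fin.cases (by simp) fun j _ => ?_) fun i => Fin.cases (by simp) fun j hij => ?_
        · simp only [Fin.cons_zero, Fin.cons_succ]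
          exact ⟨⟨(h3 j).trans (IsExposed.subset hG), fun hs => haG (h3 j (hs ha.mem))⟩,
            fun hc => haG (h3 j hc)⟩
        · simpa using h2 i j (Fin.succ_lt_succ_iff.1 hij)
      · refine Fin.cases subset_rfl fun i => ?_
        simpa using (h3 i).trans (IsExposed.subset hG)
      · rw [Fin.range_cons, h4, ← Finset.coe_insert, Finset.insert_erase haU]
    · obtain ⟨k, G', v, h1, h2, h3, h4⟩ := ih (hF.trans_convexHull hG)
        ((Finset.subset_insert_iff_of_notMem haU).1 hU)
      exact ⟨k, G', v, h1, h2, fun i => (h3 i).trans (IsExposed.subset hG), h4⟩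

/-- The family of the complete flags of a polytope. -/
noncomputable def flags (c : E →L[ℝ] ℝ) (t : Finset E) : Finset (Finset E) :=
  t.powerset.filter fun W => IsFlag c (convexHull ℝ (t : Set E)) W

theorem mem_flags {c : E →L[ℝ] ℝ} {t W : Finset E} :
    W ∈ flags c t ↔ IsFlag c (convexHull ℝ (t : Set E)) W := by
  refine ⟨fun h => (Finset.mem_filter.1 h).2, fun h => Finset.mem_filter.2 ⟨?_, h⟩⟩
  exact Finset.mem_powerset.2 fun w hw => extremePoints_convexHull_subset (h.extreme w hw)

theorem pointedTriangulation_eq [FiniteDimensional ℝ E] {c : E →L[ℝ] ℝ} {t : Finset E}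
    (hne : (convexHull ℝ (t : Set E)).Nonempty)
    (hc : InGeneralPosition c (convexHull ℝ (t : Set E))) :
    pointedTriangulation c (convexHull ℝ (t : Set E)) = simplices (subfaces (flags c t)) := by
  ext S
  constructor
  · rintro ⟨k, G, v, h1, h2, rfl⟩
    obtain ⟨W, hW, hsub⟩ := (isApexChain_of_fin k G v h1 h2).exists_isFlag t hne hc
    refine ⟨Finset.univ.image v, ⟨W, mem_flags.2 hW, ?_⟩, by simp⟩
    rw [← Finset.coe_subset]
    simpa using hsub
  · rintro ⟨U, ⟨W, hW, hU⟩, rfl⟩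
    obtain ⟨k, G, v, h1, h2, -, hr⟩ := (mem_flags.1 hW).exists_fin (IsExposed.refl _) hU
    exact ⟨k, G, v, h1, h2, by rw [hr]⟩

/-- With heights `exp (-r c)` for large `r`, every vertex lies strictly below the height function
of every flag which does not contain it. -/
theorem IsFlag.eventually_lt_height {c : E →L[ℝ] ℝ} {F : Set E} {W : Finset E}
    (hW : IsFlag c F W) (hc : InGeneralPosition c F) {v : E} (hv : v ∈ F.extremePoints ℝ)
    (hvW : v ∉ W) : ∀ᶠ r : ℝ in Filter.atTop,
      Real.exp (-(r * c v)) < height (fun u => Real.exp (-(r * c u))) W v := by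
  obtain ⟨w, μ, hw, hcw, hμ1, hμv, hpos, hz⟩ := hW.exists_weights hc hv hvW
  have hb : ∀ u ∈ W, bary W u v = μ u := fun u hu => by
    rw [← hμv, hW.affInd.bary_sum_smul hμ1 hu]
  have hexp : ∀ a : ℝ, 0 < a → Filter.Tendsto (fun r : ℝ => Real.exp (-(r * a))) Filter.atTop
      (nhds 0) := fun a ha =>
    Real.tendsto_exp_neg_atTop_nhds_zero.comp (Filter.tendsto_id.atTop_mul_const ha)
  have hlim : Filter.Tendsto (fun r : ℝ => ∑ u ∈ W, μ u * Real.exp (-(r * (c u - c w))))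
      Filter.atTop (nhds (∑ u ∈ W, if u = w then μ w else 0)) := by
    refine tendsto_finsetSum _ fun u hu => ?_
    split_ifs with huw
    · subst huw
      simp
    · have hcu : c u ≠ c w := fun h => huw (hc (hW.extreme u hu) (hW.extreme w hw) h)
      rcases lt_or_gt_of_ne hcu with h | h
      · simp [hz u hu h]
      · simpa using (hexp _ (sub_pos.2 h)).const_mul (μ u)
  rw [Finset.sum_ite_eq' W w, if_pos hw] at hlim
  filter_upwards [(hexp _ (sub_pos.2 hcw)).eventually_lt hlim hpos] with r hr
  have key : ∀ a : ℝ, Real.exp (-(r * a)) =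
      Real.exp (-(r * c w)) * Real.exp (-(r * (a - c w))) := fun a => by
    rw [← Real.exp_add]
    congr 1
    ring
  have h2 : height (fun u => Real.exp (-(r * c u))) W v =
      Real.exp (-(r * c w)) * ∑ u ∈ W, μ u * Real.exp (-(r * (c u - c w))) := by
    rw [height_apply, Finset.mul_sum]
    refine Finset.sum_congr rfl fun u hu => ?_
    rw [hb u hu, key (c u)]
    ring
  rw [h2, key (c v)]
  exact mul_lt_mul_of_pos_left hr (Real.exp_pos _)

theorem exists_isRegularFamily_flags [FiniteDimensional ℝ E] {c : E →L[ℝ] ℝ} {t : Finset E} {d : ℕ}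
    (hd : HasDim (convexHull ℝ (t : Set E)) d)
    (hc : InGeneralPosition c (convexHull ℝ (t : Set E))) :
    ∃ ht, IsRegularFamily (convexHull ℝ (t : Set E)) d (flags c t) ht := by
  have hev : ∀ᶠ r : ℝ in Filter.atTop, ∀ W ∈ flags c t, ∀ W' ∈ flags c t, ∀ v ∈ W', v ∉ W →
      Real.exp (-(r * c v)) < height (fun u => Real.exp (-(r * c u))) W v := by
    simp only [Filter.eventually_all_finset]
    intro W hW W' hW' v hv
    by_cases hvW : v ∈ W
    · simp [hvW]
    · filter_upwards [(mem_flags.1 hW).eventually_lt_height hc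
        ((mem_flags.1 hW').extreme v hv) hvW] with r hr _ using hr
  obtain ⟨r, hr⟩ := hev.exists
  refine ⟨fun u => Real.exp (-(r * c u)), convex_convexHull ℝ _, hd.1,
    fun W hW => (mem_flags.1 hW).affInd, fun W hW => ?_, fun W hW => (mem_flags.1 hW).extreme,
    fun W hW => (mem_flags.1 hW).span, fun x hx => ?_, hr⟩
  · have hF := mem_flags.1 hW
    refine hF.affInd.hasDim_iff.1 ⟨convexHull_nonempty_iff.2 hF.nonempty, ?_⟩
    have hspan : affineSpan ℝ (convexHull ℝ (W : Set E)) =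
        affineSpan ℝ (convexHull ℝ (t : Set E)) := by
      rw [affineSpan_convexHull]
      exact le_antisymm (affineSpan_mono ℝ hF.subset) (affineSpan_le.2 hF.span)
    rw [← direction_affineSpan, hspan, direction_affineSpan]
    exact hd.2
  · obtain ⟨W, hW, hxW⟩ := exists_isFlag_mem c t x hx
    exact ⟨W, mem_flags.2 hW, hxW⟩

end PointedTriangulation

theorem mainTheorem3 {e d : ℕ} (P : Set (EuclideanSpace ℝ (Fin e)))
    (hP : PointedTriangulation.IsPolytope P) (hd : PointedTriangulation.HasDim P d)
    (c : EuclideanSpace ℝ (Fin e) →L[ℝ] ℝ)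
    (hc : PointedTriangulation.InGeneralPosition c P) :
    PointedTriangulation.IsTriangulation P (PointedTriangulation.pointedTriangulation c P) ∧
    ∃ (s : ℕ) (α : Fin s → Set (EuclideanSpace ℝ (Fin e))),
      PointedTriangulation.IsShelling d (PointedTriangulation.pointedTriangulation c P) s α ∧
      ∀ j : Fin s, 0 < (j : ℕ) →
        1 ≤ PointedTriangulation.overlapCount d α j ∧
        PointedTriangulation.overlapCount d α j ≤ d - 1 := by
  obtain ⟨t, rfl⟩ := hP
  rw [PointedTriangulation.pointedTriangulation_eq hd.1 hc]
  obtain ⟨ht, h⟩ := PointedTriangulation.exists_isRegularFamily_flags hd hc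
  exact ⟨h.isTriangulation, h.exists_shelling⟩
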